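/- Let $M$ be a smooth manifold of dimension $2n+1$, let $\varepsilon_0,\varepsilon_1\in\{1,-1\}$, and let $(\varphi,\xi,\eta,g)$ be a (para)contact metric structure on $M$: $\varphi$ is a smooth $(1,1)$-tensor field, $\xi$ a smooth vector field, $\eta$ a smooth $1$-form and $g$ a smooth Riemannian or pseudo-Riemannian metric with $$\varphi^2X=\varepsilon_1(X-\eta(X)\xi),\qquad \eta(\xi)=1,\qquad g(\varphi X,\varphi Y)=-\varepsilon_1\bigl(g(X,Y)-\varepsilon_0\eta(X)\eta(Y)\bigr),$$ and $\Phi=d\eta$, where $\Phi(X,Y)=g(X,\varphi Y)$ and $2\,d\eta(X,Y)=X\eta(Y)-Y\eta(X)-\eta([X,Y])$. Let $\nabla$ be the Levi-Civita connection of $g$ and let $$P(X,Y,Z)=(\nabla_X\Phi)(Y,Z)+\varepsilon_0\varepsilon_1\,g(X,Z)\eta(Y)-\varepsilon_0\varepsilon_1\,g(X,Y)\eta(Z).$$ Suppose that $g$ has constant sectional curvature $k$, that is, every nondegenerate tangent plane of $M$ has sectional curvature $k$; if $\dim M=3$, suppose in addition that $k=-\varepsilon_0\varepsilon_1$. Then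 for every point of $M$, every $g$-orthonormal basis $(E_i)_{i=1}^{2n+1}$ of the tangent space there, with $\epsilon_i=g(E_i,E_i)=\pm1$, and all vector fields $X,Y,Z,W$, $$\sum_{i=1}^{2n+1}\epsilon_i\,P(E_i,Z,X)\,P(E_i,W,Y)=0 .$$ -/

import Mathlib

open Bundle Manifold
open scoped Manifold ContDiff Topology

namespace ParaContact

section Geometry

variable {E : Type*} [NormedAddCommGroup E] [NormedSpace ℝ E]
  {M : Type*} [TopologicalSpace M] [ChartedSpace E M] [IsManifold 𝓘(ℝ, E) ∞ M]

/-- A vector field on `M` (no regularity is built in). -/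
abbrev VField (E : Type*) [NormedAddCommGroup E] [NormedSpace ℝ E]
    (M : Type*) [TopologicalSpace M] [ChartedSpace E M] : Type _ :=
  Π p : M, TangentSpace 𝓘(ℝ, E) p

/-- The vector field `X` is differentiable at `p`. -/
def VField.DiffAt (X : VField E M) (p : M) : Prop :=
  MDifferentiableAt 𝓘(ℝ, E) 𝓘(ℝ, E).tangent (fun q ↦ (⟨q, X q⟩ : TangentBundle 𝓘(ℝ, E) M)) p

/-- The vector field `X` is smooth at `p`. -/
def VField.SmoothAt (X : VField E M) (p : M) : Prop :=
  ContMDiffAt 𝓘(ℝ, E) 𝓘(ℝ, E).tangent ∞ (fun q ↦ (⟨q, X q⟩ : TangentBundle 𝓘(ℝ, E) M)) p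

/-- The derivative `v f` of a real function `f` in the direction of the tangent vector `v`. -/
noncomputable def dirDeriv (f : M → ℝ) (p : M) (v : TangentSpace 𝓘(ℝ, E) p) : ℝ :=
  mvfderiv 𝓘(ℝ, E) f p v

variable (E M) in
/-- A smooth pseudo-Riemannian metric: a smooth field of symmetric nondegenerate bilinear forms
on the tangent spaces, of arbitrary signature. -/
structure PseudoMetric where
  /-- The scalar product on each tangent space. -/
  val (p : M) : TangentSpace 𝓘(ℝ, E) p →L[ℝ] TangentSpace 𝓘(ℝ, E) p →L[ℝ] ℝ
  symm (p : M) (v w : TangentSpace 𝓘(ℝ, E) p) : val p v w = val p w v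
  nondegenerate (p : M) (v : TangentSpace 𝓘(ℝ, E) p) (h : ∀ w, val p v w = 0) : v = 0
  smooth : ContMDiff 𝓘(ℝ, E) (𝓘(ℝ, E).prod 𝓘(ℝ, E →L[ℝ] E →L[ℝ] ℝ)) ∞
    (fun p ↦ TotalSpace.mk' (E →L[ℝ] E →L[ℝ] ℝ)
      (E := fun p : M ↦ TangentSpace 𝓘(ℝ, E) p →L[ℝ] TangentSpace 𝓘(ℝ, E) p →L[ℝ] ℝ) p (val p))

/-- A field of endomorphisms of the tangent spaces, i.e. a `(1,1)`-tensor field. -/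
abbrev EndField (E : Type*) [NormedAddCommGroup E] [NormedSpace ℝ E]
    (M : Type*) [TopologicalSpace M] [ChartedSpace E M] : Type _ :=
  Π p : M, TangentSpace 𝓘(ℝ, E) p →L[ℝ] TangentSpace 𝓘(ℝ, E) p

/-- A `1`-form. -/
abbrev OneForm (E : Type*) [NormedAddCommGroup E] [NormedSpace ℝ E]
    (M : Type*) [TopologicalSpace M] [ChartedSpace E M] : Type _ :=
  Π p : M, TangentSpace 𝓘(ℝ, E) p →L[ℝ] ℝ

/-- The exterior derivative of a `1`-form, evaluated on two vector fields, in the normalization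
`2 dη(X, Y) = X (η Y) - Y (η X) - η [X, Y]`. -/
noncomputable def extDeriv₁ (η : OneForm E M) (X Y : VField E M) (p : M) : ℝ :=
  (1 / 2) * (dirDeriv (fun q ↦ η q (Y q)) p (X p) - dirDeriv (fun q ↦ η q (X q)) p (Y p)
    - η p (VectorField.mlieBracket 𝓘(ℝ, E) X Y p))

/-- The fundamental form `Φ(v, w) = g(v, φ w)`. -/
noncomputable def fundForm (g : PseudoMetric E M) (φ : EndField E M) (p : M)
    (v w : TangentSpace 𝓘(ℝ, E) p) : ℝ :=
  g.val p v (φ p w)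

/-- `(φ, ξ, η, g)` is an almost (para)contact metric structure with signs `ε₀`, `ε₁`. -/
structure IsAlmostContactMetric (ε₀ ε₁ : ℝ) (φ : EndField E M) (ξ : VField E M)
    (η : OneForm E M) (g : PseudoMetric E M) : Prop where
  sign₀ : ε₀ = 1 ∨ ε₀ = -1
  sign₁ : ε₁ = 1 ∨ ε₁ = -1
  smooth_phi : ContMDiff 𝓘(ℝ, E) (𝓘(ℝ, E).prod 𝓘(ℝ, E →L[ℝ] E)) ∞
    (fun p ↦ TotalSpace.mk' (E →L[ℝ] E)
      (E := fun p : M ↦ TangentSpace 𝓘(ℝ, E) p →L[ℝ] TangentSpace 𝓘(ℝ, E) p) p (φ p))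
  smooth_xi : ∀ p, ξ.SmoothAt p
  smooth_eta : ContMDiff 𝓘(ℝ, E) (𝓘(ℝ, E).prod 𝓘(ℝ, E →L[ℝ] ℝ)) ∞
    (fun p ↦ TotalSpace.mk' (E →L[ℝ] ℝ)
      (E := fun p : M ↦ TangentSpace 𝓘(ℝ, E) p →L[ℝ] ℝ) p (η p))
  phi_sq : ∀ p (v : TangentSpace 𝓘(ℝ, E) p), φ p (φ p v) = ε₁ • (v - η p v • ξ p)
  eta_xi : ∀ p, η p (ξ p) = 1
  compat : ∀ p (v w : TangentSpace 𝓘(ℝ, E) p),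
    g.val p (φ p v) (φ p w) = -ε₁ * (g.val p v w - ε₀ * η p v * η p w)

/-- `(φ, ξ, η, g)` is a (para)contact metric structure: almost (para)contact metric and
`Φ = dη`. -/
structure IsContactMetric (ε₀ ε₁ : ℝ) (φ : EndField E M) (ξ : VField E M)
    (η : OneForm E M) (g : PseudoMetric E M) : Prop
    extends IsAlmostContactMetric ε₀ ε₁ φ ξ η g where
  fundForm_eq : ∀ (X Y : VField E M) (p : M), X.DiffAt p → Y.DiffAt p →
    fundForm g φ p (X p) (Y p) = extDeriv₁ η X Y p

/-- An affine connection on `M`. Caution on the order of arguments: `D Y p v` is `∇_v Y` at `p`. -/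
abbrev Connection (E : Type*) [NormedAddCommGroup E] [NormedSpace ℝ E]
    (M : Type*) [TopologicalSpace M] [ChartedSpace E M] [IsManifold 𝓘(ℝ, E) ∞ M] : Type _ :=
  CovariantDerivative 𝓘(ℝ, E) E (TangentSpace 𝓘(ℝ, E) : M → Type _)

/-- `D` is the Levi-Civita connection of `g`: it is a smooth affine connection, torsion-free and
compatible with `g`. -/
structure IsLeviCivita (g : PseudoMetric E M) (D : Connection E M) : Prop where
  smooth : ∀ (Y : VField E M) (p : M), Y.SmoothAt p →
    ContMDiffAt 𝓘(ℝ, E) (𝓘(ℝ, E).prod 𝓘(ℝ, E →L[ℝ] E)) ∞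
      (fun q ↦ TotalSpace.mk' (E →L[ℝ] E)
        (E := fun q : M ↦ TangentSpace 𝓘(ℝ, E) q →L[ℝ] TangentSpace 𝓘(ℝ, E) q) q (D Y q)) p
  torsion_free : ∀ (X Y : VField E M) (p : M), X.DiffAt p → Y.DiffAt p →
    D Y p (X p) - D X p (Y p) = VectorField.mlieBracket 𝓘(ℝ, E) X Y p
  metric : ∀ (Y Z : VField E M) (p : M) (v : TangentSpace 𝓘(ℝ, E) p), Y.DiffAt p → Z.DiffAt p →
    dirDeriv (fun q ↦ g.val q (Y q) (Z q)) p v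
      = g.val p (D Y p v) (Z p) + g.val p (Y p) (D Z p v)

/-- The curvature `R(X, Y) Z = ∇_X ∇_Y Z - ∇_Y ∇_X Z - ∇_[X, Y] Z`. -/
noncomputable def curvature (D : Connection E M) (X Y Z : VField E M) : VField E M := fun p ↦
  D (fun q ↦ D Z q (Y q)) p (X p) - D (fun q ↦ D Z q (X q)) p (Y p)
    - D Z p (VectorField.mlieBracket 𝓘(ℝ, E) X Y p)

/-- The Gram determinant `g(v, v) g(w, w) - g(v, w)²`. For linearly independent `v`, `w` it is
nonzero exactly when `g` is nondegenerate on the plane spanned by them. -/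
noncomputable def gram (g : PseudoMetric E M) (p : M) (v w : TangentSpace 𝓘(ℝ, E) p) : ℝ :=
  g.val p v v * g.val p w w - g.val p v w ^ 2

/-- The sectional curvature `g(R(X, Y) Y, X) / (g(X, X) g(Y, Y) - g(X, Y)²)` at `p` of the plane
spanned by `X p` and `Y p`. -/
noncomputable def sectionalCurvature (g : PseudoMetric E M) (D : Connection E M)
    (X Y : VField E M) (p : M) : ℝ :=
  g.val p (curvature D X Y Y p) (X p) / gram g p (X p) (Y p)

/-- All nondegenerate tangent planes have sectional curvature `k`. -/
def HasConstantSectionalCurvature (g : PseudoMetric E M) (D : Connection E M) (k : ℝ) : Prop :=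
  ∀ (X Y : VField E M) (p : M), X.SmoothAt p → Y.SmoothAt p → gram g p (X p) (Y p) ≠ 0 →
    sectionalCurvature g D X Y p = k

/-- The covariant derivative of the fundamental form,
`(∇_v Φ)(Y, Z) = v (Φ(Y, Z)) - Φ(∇_v Y, Z) - Φ(Y, ∇_v Z)`. -/
noncomputable def nablaFundForm (g : PseudoMetric E M) (D : Connection E M) (φ : EndField E M)
    (p : M) (v : TangentSpace 𝓘(ℝ, E) p) (Y Z : VField E M) : ℝ :=
  dirDeriv (fun q ↦ fundForm g φ q (Y q) (Z q)) p v
    - fundForm g φ p (D Y p v) (Z p) - fundForm g φ p (Y p) (D Z p v)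

/-- `P(v, Y, Z) = (∇_v Φ)(Y, Z) + ε₀ ε₁ g(v, Z) η(Y) - ε₀ ε₁ g(v, Y) η(Z)` at `p`. -/
noncomputable def tensorP (ε₀ ε₁ : ℝ) (g : PseudoMetric E M) (D : Connection E M)
    (φ : EndField E M) (η : OneForm E M) (p : M) (v : TangentSpace 𝓘(ℝ, E) p)
    (Y Z : VField E M) : ℝ :=
  nablaFundForm g D φ p v Y Z + ε₀ * ε₁ * g.val p v (Z p) * η p (Y p)
    - ε₀ * ε₁ * g.val p v (Y p) * η p (Z p)

/-- `e` is a `g`-orthonormal family of tangent vectors at `p`: `g(eᵢ, eⱼ) = ± δᵢⱼ`. -/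
def IsOrthonormalAt (g : PseudoMetric E M) (p : M) {ι : Type*}
    (e : ι → TangentSpace 𝓘(ℝ, E) p) : Prop :=
  (∀ i, g.val p (e i) (e i) = 1 ∨ g.val p (e i) (e i) = -1) ∧
    ∀ i j, i ≠ j → g.val p (e i) (e j) = 0

end Geometry

end ParaContact

/-! Replacing `g`, `φ` by `ε₀ g`, `ε₀ φ` gives `g(ξ, ξ) = 1` and `η = g(ξ, ·)`, keeps `Φ`, turns the
curvature into `ε₀ k` and leaves one sign `e = ε₁`. Smooth fields over smooth functions then form a
purely algebraic structure, in which the tensor calculus takes place. Write `k` for the new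
curvature; the claim concerns `k = -e`.

Write `∇ξ = S - φ` with `S` self-adjoint, and `P(X, Y, Z) = g(Y, P(X, Z))`. The Ricci identity for
`ξ` gives the cyclic identity for `P`, then `P(ξ, ·) = 0`, `S φ = -φ S` and `S² = -(e + k)(1 - η ⊗
ξ)` (`P_cyc`, `S_φ`, `S_S`). On horizontal fields `φ` passes between all slots of `P`, and
differentiating `S φ + φ S = 0` yields `P(S X, Y, Z) = 0` (`p_S_left`).

If `k ≠ -e`, then `S` is invertible on horizontal fields, so the horizontal part of `P` vanishes and
the Ricci identity for `φ` becomes algebraic. Its contraction carries the factor `dim - 3` and is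
contradictory in dimension at least five (`false_of_ricci`). In dimension three the value of `k` is
a hypothesis, and in dimension one `P = 0`.

If `k = -e`, let `T(X, Y) = P(X, Y) - P(Y, X)`; the cyclic identity says `P(Z, X, Y) = g(Z, T(X,
Y))`. Hence the sum over an orthonormal basis is, up to sign, `g(T(Z, X), T(W, Y))`, and the theorem
says that the values of `T` span an isotropic space (`g_T_T`). On horizontal fields, commuting
second derivatives of `φ` gives a Bianchi identity for the quadratic expression `g(T, T)`
(`gray_bianchi`), and twisting two arguments by `φ` changes the relative sign of its terms, so each
vanishes. The remaining components lie in the image of `S`, which is isotropic since `S² = 0` and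
orthogonal to the horizontal part of `T` by `p_S_left`. -/

namespace ParaContact

/-! ### Metric connections over a ring of functions -/

/-- A module `𝔛` of "vector fields" over a ring `R` of "functions", with a metric `g` and its
Levi-Civita connection: `nab X Y` is `∇_X Y` and `der X f` is `X f`. -/
structure KoszulAlgebra (R 𝔛 : Type*) [CommRing R] [AddCommGroup 𝔛] [Module R 𝔛] where
  nab : 𝔛 →ₗ[R] 𝔛 →+ 𝔛
  der : 𝔛 → R → R
  g : 𝔛 →ₗ[R] 𝔛 →ₗ[R] R
  two_cancel (x : R) : 2 * x = 0 → x = 0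
  faithful (f : R) : (∀ X : 𝔛, f • X = 0) → f = 0
  nab_smul (X Y : 𝔛) (f : R) : nab X (f • Y) = der X f • Y + f • nab X Y
  der_g (X Y Z : 𝔛) : der X (g Y Z) = g (nab X Y) Z + g Y (nab X Z)
  g_symm (X Y : 𝔛) : g X Y = g Y X
  nondeg (X : 𝔛) : (∀ Y, g X Y = 0) → X = 0
  jacobi (X Y Z : 𝔛) :
    nab X (nab Y Z - nab Z Y) - nab (nab Y Z - nab Z Y) X
    + (nab Y (nab Z X - nab X Z) - nab (nab Z X - nab X Z) Y)
    + (nab Z (nab X Y - nab Y X) - nab (nab X Y - nab Y X) Z) = 0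

namespace KoszulAlgebra

variable {R 𝔛 : Type*} [CommRing R] [AddCommGroup 𝔛] [Module R 𝔛] (A : KoszulAlgebra R 𝔛)

/-- Nothing is assumed about `der` beyond the Leibniz rule for `nab`; faithfulness of the module
makes that rule determine `der`. -/
theorem der_add (V : 𝔛) (f h : R) : A.der V (f + h) = A.der V f + A.der V h := by
  rw [← sub_eq_zero]
  refine A.faithful _ fun X ↦ ?_
  have h₁ := A.nab_smul V X (f + h)
  rw [add_smul, map_add, A.nab_smul, A.nab_smul] at h₁
  linear_combination (norm := module) -h₁

theorem der_zero (V : 𝔛) : A.der V 0 = 0 := by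
  have := A.der_add V 0 0
  rw [add_zero] at this
  linear_combination -this

theorem der_neg (V : 𝔛) (f : R) : A.der V (-f) = -A.der V f := by
  have := A.der_add V f (-f)
  rw [add_neg_cancel, A.der_zero] at this
  linear_combination -this

theorem der_one (V : 𝔛) : A.der V 1 = 0 := by
  refine A.faithful _ fun X ↦ ?_
  have h₁ := A.nab_smul V X 1
  rw [one_smul, one_smul] at h₁
  linear_combination (norm := module) -h₁

/-- The curvature tensor. -/
def curv (X Y Z : 𝔛) : 𝔛 :=
  A.nab X (A.nab Y Z) - A.nab Y (A.nab X Z) - A.nab (A.nab X Y - A.nab Y X) Z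

/-- The Jacobi identity for `X, Y, f Z`, minus `f` times the one for `X, Y, Z`, leaves exactly this
operator applied to `f`, times `Z`. -/
theorem der_der (X Y : 𝔛) (f : R) :
    A.der X (A.der Y f) - A.der Y (A.der X f) = A.der (A.nab X Y - A.nab Y X) f := by
  rw [← sub_eq_zero]
  refine A.faithful _ fun Z ↦ ?_
  have h := A.jacobi X Y (f • Z)
  have h' := congrArg (f • ·) (A.jacobi X Y Z)
  simp only [A.nab_smul, map_sub, map_add, map_smul, AddMonoidHom.sub_apply,
    AddMonoidHom.add_apply, AddMonoidHom.smul_apply, smul_zero] at h h'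
  have h₂ := A.nab_smul (A.nab X Y - A.nab Y X) Z f
  rw [map_sub, AddMonoidHom.sub_apply, A.nab_smul, A.nab_smul, AddMonoidHom.sub_apply] at h₂
  linear_combination (norm := module) h - h' + h₂

theorem curv_swap (X Y Z : 𝔛) : A.curv X Y Z = -A.curv Y X Z := by
  simp only [curv, map_sub, AddMonoidHom.sub_apply]
  abel

theorem curv_add_left (X X' Y Z : 𝔛) : A.curv (X + X') Y Z = A.curv X Y Z + A.curv X' Y Z := by
  simp only [curv, map_sub, map_add, AddMonoidHom.sub_apply, AddMonoidHom.add_apply]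
  abel

theorem curv_smul_left (f : R) (X Y Z : 𝔛) : A.curv (f • X) Y Z = f • A.curv X Y Z := by
  simp only [curv, map_sub, map_add, map_smul, A.nab_smul, AddMonoidHom.sub_apply,
    AddMonoidHom.add_apply, AddMonoidHom.smul_apply]
  module

theorem bianchi (X Y Z : 𝔛) : A.curv X Y Z + A.curv Y Z X + A.curv Z X Y = 0 := by
  have h := A.jacobi X Y Z
  simp only [curv, map_sub, AddMonoidHom.sub_apply] at h ⊢
  rw [← h]
  abel

theorem g_curv_swap (X Y Z W : 𝔛) : A.g (A.curv X Y Z) W = -A.g (A.curv X Y W) Z := by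
  have h := A.der_der X Y (A.g Z W)
  simp only [A.der_g, A.der_add] at h
  simp only [curv, map_sub, LinearMap.sub_apply, AddMonoidHom.sub_apply] at h ⊢
  linear_combination (norm := (simp only [A.g_symm]; ring1)) h

/-- The difference between the curvature tensor and that of a space of constant curvature `k`. -/
def excess (k : R) (X Y Z W : 𝔛) : R :=
  A.g (A.curv X Y Z) W - k * (A.g Y Z * A.g X W - A.g X Z * A.g Y W)

theorem excess_add_left (k : R) (X X' Y Z W : 𝔛) :
    A.excess k (X + X') Y Z W = A.excess k X Y Z W + A.excess k X' Y Z W := by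
  simp only [excess, curv_add_left, map_add, LinearMap.add_apply]; ring

theorem excess_smul_left (k f : R) (X Y Z W : 𝔛) :
    A.excess k (f • X) Y Z W = f * A.excess k X Y Z W := by
  simp only [excess, curv_smul_left, map_smul, LinearMap.smul_apply, smul_eq_mul]; ring

theorem excess_swap (k : R) (X Y Z W : 𝔛) : A.excess k X Y Z W = -A.excess k Y X Z W := by
  rw [excess, excess, A.curv_swap X Y, map_neg, LinearMap.neg_apply]; ring

theorem excess_swap' (k : R) (X Y Z W : 𝔛) : A.excess k X Y Z W = -A.excess k X Y W Z := by
  rw [excess, excess, A.g_curv_swap]; ring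

theorem excess_bianchi (k : R) (X Y Z W : 𝔛) :
    A.excess k X Y Z W + A.excess k Y Z X W + A.excess k Z X Y W = 0 := by
  have h := congrArg (fun V ↦ A.g V W) (A.bianchi X Y Z)
  simp only [map_add, LinearMap.add_apply, map_zero, LinearMap.zero_apply] at h
  rw [excess, excess, excess]
  linear_combination h + k * (A.g X W * A.g_symm Z Y + A.g Y W * A.g_symm X Z
    + A.g Z W * A.g_symm Y X)

end KoszulAlgebra

/-! ### Contact structures of constant curvature: first-order identities -/

/-- A Koszul algebra of constant curvature `k` with a (para)contact metric structure whose Reeb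
field has square length `1`. -/
structure ContactAlgebra (R 𝔛 : Type*) [CommRing R] [AddCommGroup 𝔛] [Module R 𝔛]
    extends KoszulAlgebra R 𝔛 where
  φ : 𝔛 →ₗ[R] 𝔛
  ξ : 𝔛
  e : R
  k : R
  der_e (X : 𝔛) : der X e = 0
  e_mul_e : e * e = 1
  g_ξ_ξ : g ξ ξ = 1
  φ_φ (X : 𝔛) : φ (φ X) = e • (X - g ξ X • ξ)
  φ_ξ : φ ξ = 0
  g_φ (X Y : 𝔛) : g (φ X) Y = - g X (φ Y)
  contact (X Y : 𝔛) : 2 * g X (φ Y) = g (nab X ξ) Y - g (nab Y ξ) X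
  curv_eq (X Y Z : 𝔛) : toKoszulAlgebra.curv X Y Z = k • (g Y Z • X - g X Z • Y)

namespace ContactAlgebra

variable {R 𝔛 : Type*} [CommRing R] [AddCommGroup 𝔛] [Module R 𝔛] (A : ContactAlgebra R 𝔛)

/-- Two fields are equal if they have the same scalar products with all fields. -/
theorem ext_g {X Y : 𝔛} (h : ∀ Z, A.g X Z = A.g Y Z) : X = Y := by
  rw [← sub_eq_zero]
  refine A.nondeg _ fun Z ↦ ?_
  simp [h Z]

theorem eq_of_two_mul (A : ContactAlgebra R 𝔛) {x y : R} (h : 2 * x = 2 * y) : x = y := by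
  rw [← sub_eq_zero]
  exact A.two_cancel _ (by linear_combination h)

theorem eq_of_two_smul (A : ContactAlgebra R 𝔛) {X Y : 𝔛} (h : (2 : R) • X = (2 : R) • Y) :
    X = Y := by
  refine A.ext_g fun Z ↦ A.eq_of_two_mul ?_
  simpa using congrArg (fun W ↦ A.g W Z) h

/-- The symmetric part of the covariant derivative of the Reeb field. -/
def S : 𝔛 →ₗ[R] 𝔛 where
  toFun X := A.nab X A.ξ + A.φ X
  map_add' X Y := by simp; abel
  map_smul' f X := by simp

theorem nab_ξ (X : 𝔛) : A.nab X A.ξ = A.S X - A.φ X := by simp [S]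

@[simp] theorem g_ξ_φ (X : 𝔛) : A.g A.ξ (A.φ X) = 0 := by
  have := A.g_φ A.ξ X
  rw [A.φ_ξ] at this
  simpa using this.symm

@[simp] theorem g_φ_ξ (X : 𝔛) : A.g (A.φ X) A.ξ = 0 := by rw [A.g_symm]; simp

theorem g_S (X Y : 𝔛) : A.g (A.S X) Y = A.g X (A.S Y) := by
  have h := A.contact X Y
  rw [A.nab_ξ, A.nab_ξ] at h
  simp only [map_sub, LinearMap.sub_apply] at h
  linear_combination -h + A.g_φ X Y - A.g_symm (A.φ Y) X + A.g_symm (A.S Y) X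

@[simp] theorem g_ξ_S (X : 𝔛) : A.g A.ξ (A.S X) = 0 := by
  have h := A.der_g X A.ξ A.ξ
  rw [A.g_ξ_ξ, A.der_one, A.nab_ξ] at h
  apply A.two_cancel
  simp only [map_sub, LinearMap.sub_apply, g_φ_ξ, g_ξ_φ] at h
  linear_combination -h - A.g_symm (A.S X) A.ξ

@[simp] theorem S_ξ : A.S A.ξ = 0 := A.ext_g fun Z ↦ by rw [A.g_S]; simp

@[simp] theorem φ_ξ' : A.φ A.ξ = 0 := A.φ_ξ

@[simp] theorem g_ξ_ξ' : A.g A.ξ A.ξ = 1 := A.g_ξ_ξ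

theorem g_φ_φ (X Y : 𝔛) :
    A.g (A.φ X) (A.φ Y) = -A.e * (A.g X Y - A.g A.ξ X * A.g A.ξ Y) := by
  rw [A.g_φ, A.φ_φ]
  simp only [map_smul, map_sub, smul_eq_mul]
  linear_combination A.e * A.g A.ξ Y * A.g_symm X A.ξ

/-- The covariant derivative of `φ`, corrected by the terms it has in the Sasakian case. -/
def P : 𝔛 →ₗ[R] 𝔛 →ₗ[R] 𝔛 :=
  LinearMap.mk₂ R
    (fun X Z ↦ A.nab X (A.φ Z) - A.φ (A.nab X Z) + A.e • (A.g X Z • A.ξ - A.g A.ξ Z • X))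
    (fun X Y Z ↦ by simp only [map_add, AddMonoidHom.add_apply, LinearMap.add_apply]; module)
    (fun f X Z ↦ by simp only [map_smul, AddMonoidHom.smul_apply, LinearMap.smul_apply]; module)
    (fun X Y Z ↦ by simp only [map_add]; module)
    (fun f X Z ↦ by simp only [map_smul, A.nab_smul, map_add]; module)

theorem P_apply (X Z : 𝔛) : A.P X Z =
    A.nab X (A.φ Z) - A.φ (A.nab X Z) + A.e • (A.g X Z • A.ξ - A.g A.ξ Z • X) := rfl

theorem nab_φ (X Z : 𝔛) : A.nab X (A.φ Z) =
    A.φ (A.nab X Z) + A.P X Z - A.e • (A.g X Z • A.ξ - A.g A.ξ Z • X) := by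
  rw [P_apply]; abel

/-- The covariant derivative of `S`. -/
def H : 𝔛 →ₗ[R] 𝔛 →ₗ[R] 𝔛 :=
  LinearMap.mk₂ R (fun X Z ↦ A.nab X (A.S Z) - A.S (A.nab X Z))
    (fun X Y Z ↦ by simp only [map_add, AddMonoidHom.add_apply]; module)
    (fun f X Z ↦ by simp only [map_smul, AddMonoidHom.smul_apply]; module)
    (fun X Y Z ↦ by simp only [map_add]; module)
    (fun f X Z ↦ by simp only [map_smul, A.nab_smul, map_add]; module)

theorem nab_S (X Z : 𝔛) : A.nab X (A.S Z) = A.S (A.nab X Z) + A.H X Z := by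
  simp [H]

/-- The covariant derivative of the contact form. -/
theorem der_η (X Y : 𝔛) : A.der X (A.g A.ξ Y) =
    A.g (A.S X) Y - A.g (A.φ X) Y + A.g A.ξ (A.nab X Y) := by
  rw [A.der_g, A.nab_ξ]; simp

theorem P_skew (X Y Z : 𝔛) : A.g (A.P X Y) Z = - A.g (A.P X Z) Y := by
  have h := congrArg (A.der X) (A.g_φ Y Z)
  rw [A.der_neg, A.der_g, A.der_g, A.nab_φ, A.nab_φ] at h
  simp only [map_add, map_sub, map_smul, LinearMap.add_apply, LinearMap.sub_apply,
    LinearMap.smul_apply, smul_eq_mul] at h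
  linear_combination (norm := (simp only [A.g_symm]; ring1))
    h - A.g_φ (A.nab X Y) Z - A.g_φ Y (A.nab X Z)

theorem H_symm (X Y Z : 𝔛) : A.g (A.H X Y) Z = A.g (A.H X Z) Y := by
  have h := congrArg (A.der X) (A.g_S Y Z)
  rw [A.der_g, A.der_g, A.nab_S, A.nab_S] at h
  simp only [map_add, LinearMap.add_apply] at h
  linear_combination h - A.g_S (A.nab X Y) Z - A.g_S Y (A.nab X Z) + A.g_symm Y (A.H X Z)

@[simp] theorem P_right_ξ (X : 𝔛) : A.P X A.ξ = -A.φ (A.S X) := by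
  rw [P_apply, A.φ_ξ, A.nab_ξ, map_sub, A.φ_φ, A.g_ξ_ξ, map_zero, A.g_symm X A.ξ]
  module

theorem g_P_ξ (X Y : 𝔛) : A.g (A.P X Y) A.ξ = A.g (A.φ (A.S X)) Y := by
  rw [A.P_skew]; simp

/-- The Ricci identity for the Reeb field. -/
theorem H_sub_H (X Y : 𝔛) : A.H X Y - A.H Y X =
    A.P X Y - A.P Y X + (A.e + A.k) • (A.g A.ξ Y • X - A.g A.ξ X • Y) := by
  have h := A.curv_eq X Y A.ξ
  rw [KoszulAlgebra.curv, A.nab_ξ, A.nab_ξ, A.nab_ξ, map_sub, map_sub, A.nab_S, A.nab_S,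
    A.nab_φ, A.nab_φ, map_sub, map_sub, A.g_symm Y A.ξ, A.g_symm X A.ξ, A.g_symm Y X] at h
  linear_combination (norm := module) h

/-- This is `dΦ = 0`. In the cyclic sum of `H_sub_H` the left side cancels because each `H X` is
self-adjoint, and skewness of each `P X` makes the right side twice the sum wanted. -/
theorem P_cyc (X Y Z : 𝔛) :
    A.g (A.P X Y) Z + A.g (A.P Y Z) X + A.g (A.P Z X) Y = 0 := by
  have h (U V W : 𝔛) := congrArg (fun X ↦ A.g X W) (A.H_sub_H U V)
  simp only [map_add, map_sub, map_smul, LinearMap.add_apply, LinearMap.sub_apply,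
    LinearMap.smul_apply, smul_eq_mul] at h
  apply A.two_cancel
  linear_combination -h X Y Z - h Y Z X - h Z X Y + A.H_symm X Y Z + A.H_symm Y Z X
    + A.H_symm Z X Y + A.P_skew X Y Z + A.P_skew Y Z X + A.P_skew Z X Y
    + (A.e + A.k) * (A.g A.ξ X * A.g_symm Y Z + A.g A.ξ Y * A.g_symm Z X
      + A.g A.ξ Z * A.g_symm X Y)

theorem H_ξ_eq (X : 𝔛) : A.H A.ξ X = A.S (A.φ X) + A.φ (A.S X) + A.P A.ξ X
    - A.S (A.S X) - (A.e + A.k) • (X - A.g A.ξ X • A.ξ) := by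
  have h := A.H_sub_H X A.ξ
  have h' : A.H X A.ξ = A.S (A.φ X) - A.S (A.S X) := by
    have := A.nab_S X A.ξ
    rw [A.S_ξ, map_zero, A.nab_ξ, map_sub] at this
    linear_combination (norm := module) -this
  rw [h', A.P_right_ξ, A.g_ξ_ξ] at h
  linear_combination (norm := module) -h

/-- In `H_ξ_eq` the operators `H ξ`, `S²` and the projection are self-adjoint, while `P ξ` and `S φ
+ φ S` are skew; the skew part must vanish. -/
theorem P_ξ_eq (X : 𝔛) : A.P A.ξ X = -(A.S (A.φ X) + A.φ (A.S X)) := by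
  refine A.ext_g fun Z ↦ A.eq_of_two_mul ?_
  have h := A.H_symm A.ξ X Z
  rw [A.H_ξ_eq, A.H_ξ_eq] at h
  simp only [map_add, map_sub, map_neg, map_smul, LinearMap.add_apply, LinearMap.sub_apply,
    LinearMap.neg_apply, LinearMap.smul_apply, smul_eq_mul] at h ⊢
  linear_combination (norm := (simp only [A.g_symm]; ring1)) h + A.P_skew A.ξ X Z
    + A.g_S (A.S X) Z - A.g_S (A.S Z) X + A.g_φ (A.S Z) X + A.g_S (A.φ X) Z
    + A.g_S (A.φ Z) X + A.g_φ Z (A.S X)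

theorem H_ξ (X : 𝔛) :
    A.H A.ξ X = - A.S (A.S X) - (A.e + A.k) • (X - A.g A.ξ X • A.ξ) := by
  rw [A.H_ξ_eq, A.P_ξ_eq]; module

/-- The covariant derivative of `φ² = e (1 - η ⊗ ξ)`. -/
theorem P_φ (X Y : 𝔛) : A.P X (A.φ Y) + A.φ (A.P X Y) =
    -(A.e * A.g (A.S X) Y) • A.ξ - (A.e * A.g A.ξ Y) • A.S X := by
  have h := congrArg (A.nab X) (A.φ_φ Y)
  rw [A.nab_φ, A.nab_φ, A.nab_smul, A.der_e, map_sub (A.nab X), A.nab_smul, A.der_η, A.nab_ξ] at h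
  simp only [map_add, map_sub, map_smul, A.φ_φ, A.φ_ξ, g_ξ_φ] at h
  have h' := A.g_φ X Y
  rw [eq_neg_iff_add_eq_zero, add_comm, ← eq_neg_iff_add_eq_zero] at h'
  rw [h'] at h
  linear_combination (norm := module) h

/-- Inserting `P_ξ_eq` into `P_φ` along `ξ` gives `φ S φ = -e S`; applying `φ` once more gives
anticommutation. -/
theorem S_φ (X : 𝔛) : A.S (A.φ X) = -A.φ (A.S X) := by
  have hφS (Y : 𝔛) : A.φ (A.φ (A.S Y)) = A.e • A.S Y := by rw [A.φ_φ]; simp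
  have hSφ (Y : 𝔛) : A.S (A.φ (A.φ Y)) = A.e • A.S Y := by rw [A.φ_φ]; simp
  have h (Y : 𝔛) : A.φ (A.S (A.φ Y)) = -(A.e • A.S Y) := by
    have h := A.P_φ A.ξ Y
    rw [A.P_ξ_eq, A.P_ξ_eq, map_neg, map_add, hφS, hSφ] at h
    simp only [S_ξ, map_zero, LinearMap.zero_apply, mul_zero, neg_zero, zero_smul, smul_zero,
      sub_zero] at h
    refine A.eq_of_two_smul ?_
    linear_combination (norm := module) -h
  have h' := congrArg A.φ (h X)
  rw [A.φ_φ, map_neg, map_smul] at h'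
  simp only [g_ξ_S, zero_smul, sub_zero, ← smul_neg] at h'
  have := congrArg (A.e • ·) h'
  simpa only [smul_smul, A.e_mul_e, one_smul] using this

@[simp] theorem P_ξ (X : 𝔛) : A.P A.ξ X = 0 := by rw [A.P_ξ_eq, A.S_φ]; simp

/-- Since `∇_ξ φ = 0`, differentiating `S φ = -φ S` along `ξ` shows that `H ξ` anticommutes with
`φ`. By `H_ξ` it also commutes with `φ`, so it vanishes on the image of `φ`. -/
theorem S_S (X : 𝔛) : A.S (A.S X) = -((A.e + A.k) • (X - A.g A.ξ X • A.ξ)) := by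
  have h (Y : 𝔛) : A.S (A.S (A.φ Y)) = -((A.e + A.k) • A.φ Y) := by
    have h := congrArg (A.nab A.ξ) (A.S_φ Y)
    rw [A.nab_S, A.nab_φ, map_neg, A.nab_φ, A.nab_S, A.H_ξ, A.P_ξ, A.P_ξ, A.H_ξ] at h
    simp only [map_add, map_sub, map_neg, map_smul, g_ξ_φ, g_ξ_S, S_ξ, φ_ξ', map_zero] at h
    rw [A.S_φ (A.nab A.ξ Y)] at h
    have h' : A.φ (A.S (A.S Y)) = A.S (A.S (A.φ Y)) := by rw [A.S_φ, map_neg, A.S_φ, neg_neg]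
    rw [h'] at h
    refine A.eq_of_two_smul ?_
    linear_combination (norm := module) -h
  have h' := congrArg (A.e • ·) (h (A.φ X))
  simp only [A.φ_φ, map_smul, map_sub, S_ξ, smul_zero, sub_zero, smul_smul, A.e_mul_e,
    one_smul] at h'
  rw [h', smul_neg, smul_smul, ← mul_assoc, mul_right_comm, A.e_mul_e, one_mul]


end ContactAlgebra

end ParaContact

/-! ### The tensor `P` on horizontal fields -/

namespace ParaContact
namespace ContactAlgebra

variable {R 𝔛 : Type*} [CommRing R] [AddCommGroup 𝔛] [Module R 𝔛] (A : ContactAlgebra R 𝔛)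

/-- The scalar form of the tensor `P`. -/
def p (X Y Z : 𝔛) : R := A.g Y (A.P X Z)

theorem p_skew (X Y Z : 𝔛) : A.p X Y Z = -A.p X Z Y := by
  rw [p, p, A.g_symm, A.P_skew, A.g_symm]

theorem p_cyc (X Y Z : 𝔛) : A.p X Y Z + A.p Y Z X + A.p Z X Y = 0 := by
  have := A.P_cyc X Y Z
  unfold p
  rw [A.P_skew X, A.P_skew Y, A.P_skew Z, A.g_symm _ X, A.g_symm _ Y, A.g_symm _ Z] at this
  linear_combination -this

theorem p_φ (X Y Z : 𝔛) : A.p X Y (A.φ Z) = A.p X (A.φ Y) Z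
    - A.e * (A.g (A.S X) Z * A.g A.ξ Y + A.g A.ξ Z * A.g (A.S X) Y) := by
  have h := congrArg (A.g Y) (A.P_φ X Z)
  simp only [map_add, map_sub, map_smul, smul_eq_mul] at h
  rw [p, p]
  linear_combination h - A.g_φ Y (A.P X Z) - A.e * A.g (A.S X) Z * A.g_symm Y A.ξ
    - A.e * A.g A.ξ Z * A.g_symm Y (A.S X)

theorem φ_φ_of_horizontal {X : 𝔛} (hX : A.g A.ξ X = 0) : A.φ (A.φ X) = A.e • X := by
  rw [A.φ_φ, hX, zero_smul, sub_zero]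

theorem p_φ_of_horizontal (X : 𝔛) {Y Z : 𝔛} (hY : A.g A.ξ Y = 0) (hZ : A.g A.ξ Z = 0) :
    A.p X Y (A.φ Z) = A.p X (A.φ Y) Z := by
  rw [p_φ, hY, hZ]; ring

@[simp] theorem p_smul_left (X Y Z : 𝔛) (f : R) : A.p (f • X) Y Z = f * A.p X Y Z := by simp [p]
@[simp] theorem p_smul_mid (X Y Z : 𝔛) (f : R) : A.p X (f • Y) Z = f * A.p X Y Z := by simp [p]
@[simp] theorem p_smul_right (X Y Z : 𝔛) (f : R) : A.p X Y (f • Z) = f * A.p X Y Z := by simp [p]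
@[simp] theorem p_neg_left (X Y Z : 𝔛) : A.p (-X) Y Z = -A.p X Y Z := by simp [p]
@[simp] theorem p_neg_right (X Y Z : 𝔛) : A.p X Y (-Z) = -A.p X Y Z := by simp [p]
@[simp] theorem p_ξ_left (Y Z : 𝔛) : A.p A.ξ Y Z = 0 := by simp [p]

/-- Linear algebra with four cyclic identities: three with one `φ`, and the one with `φ` in every
slot, where two of them merge into `φ² = e`. Together they annihilate both `∑ p (φ X) Y Z` and `∑ p
X (φ Y) Z`, and a single-`φ` identity then gives the equality. -/
theorem p_φ_left {X Y Z : 𝔛} (hX : A.g A.ξ X = 0) (hY : A.g A.ξ Y = 0) (hZ : A.g A.ξ Z = 0) :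
    A.p (A.φ X) Y Z = A.p X (A.φ Y) Z := by
  have h := A.p_cyc (A.φ X) (A.φ Y) (A.φ Z)
  rw [A.p_φ _ _ Z, A.p_φ _ _ X, A.p_φ _ _ Y, A.φ_φ_of_horizontal hX, A.φ_φ_of_horizontal hY,
    A.φ_φ_of_horizontal hZ] at h
  simp only [p_smul_mid, g_ξ_φ, hX, hY, hZ, mul_zero, zero_mul, sub_zero, add_zero] at h
  have hX' := A.p_cyc (A.φ X) Y Z
  have hY' := A.p_cyc X (A.φ Y) Z
  have hZ' := A.p_cyc X Y (A.φ Z)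
  rw [A.p_φ_of_horizontal _ hY hZ] at hZ'
  rw [A.p_φ_of_horizontal _ hZ hX] at hX'
  rw [A.p_φ_of_horizontal _ hX hY] at hY'
  apply A.eq_of_two_mul
  linear_combination hX' - hY' - hZ' + A.e * h - (A.p (A.φ X) Y Z + A.p (A.φ Y) Z X
    + A.p (A.φ Z) X Y) * A.e_mul_e

/-- The derivative of the relation `S φ + φ S = 0` on horizontal fields. -/
theorem g_H_φ (X : 𝔛) {Y Z : 𝔛} (hY : A.g A.ξ Y = 0) (hZ : A.g A.ξ Z = 0) :
    A.g (A.H X (A.φ Y)) Z = A.g (A.H X Y) (A.φ Z) + A.p X (A.S Y) Z + A.p X Y (A.S Z) := by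
  have h := congrArg (fun W ↦ A.g (A.nab X W) Z) (A.S_φ Y)
  rw [map_neg, A.nab_S, A.nab_φ, A.nab_φ, A.nab_S] at h
  simp only [map_add, map_sub, map_neg, map_smul, LinearMap.add_apply, LinearMap.sub_apply,
    LinearMap.neg_apply, LinearMap.smul_apply, smul_eq_mul, hY, hZ, zero_smul, smul_zero, S_ξ,
    g_ξ_S, sub_zero, mul_zero] at h
  rw [S_φ] at h
  simp only [map_neg, LinearMap.neg_apply] at h
  rw [p, p]
  linear_combination (norm := (simp only [A.g_symm]; ring1)) h - A.g_φ (A.H X Y) Z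
    - A.P_skew X (A.S Y) Z - A.P_skew X Y (A.S Z) - A.g_S (A.P X Y) Z

theorem g_H_sub_H {X Y : 𝔛} (Z : 𝔛) (hX : A.g A.ξ X = 0) (hY : A.g A.ξ Y = 0) :
    A.g (A.H X Y) Z - A.g (A.H Y X) Z = A.p Z X Y := by
  have h := congrArg (fun W ↦ A.g W Z) (A.H_sub_H X Y)
  simp only [hX, hY, map_sub, LinearMap.sub_apply, zero_smul, sub_zero, smul_zero, add_zero] at h
  have h' := A.p_cyc X Y Z
  have h'' := A.p_skew X Y Z
  unfold p at *
  linear_combination h + A.g_symm (A.P X Y) Z - A.g_symm (A.P Y X) Z - h' + h''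

/-- The skew part of `H` is known from `P`, and `g_H_φ` moves `φ` across `H` at the cost of terms
with `S`. Moving `φ` around a closed circuit makes the skew parts cancel, and the accumulated cost
must be zero. -/
theorem p_φ_S_left {X Y Z : 𝔛} (hX : A.g A.ξ X = 0) (hY : A.g A.ξ Y = 0)
    (hZ : A.g A.ξ Z = 0) : A.p (A.φ (A.S Z)) X Y = 0 := by
  have hφ (W : 𝔛) : A.g A.ξ (A.φ W) = 0 := A.g_ξ_φ W
  have hS (W : 𝔛) : A.g A.ξ (A.S W) = 0 := A.g_ξ_S W
  have t₁ := A.g_H_sub_H (A.φ Z) hX (hφ Y)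
  have t₂ := A.g_H_sub_H (A.φ Z) (hφ X) hY
  have t₃ := A.g_H_sub_H Z hX hY
  have t₄ := A.g_H_sub_H Z (hφ X) (hφ Y)
  have u₁ := A.g_H_φ X hY (hφ Z)
  have u₂ := A.g_H_φ (A.φ Y) hX hZ
  have u₃ := A.g_H_φ (A.φ X) hY hZ
  have u₄ := A.g_H_φ Y hX (hφ Z)
  rw [A.p_φ_left hZ hX (hφ Y), ← A.p_φ_of_horizontal _ hX (hφ Y),
    A.φ_φ_of_horizontal hY, p_smul_right] at t₁
  rw [A.p_φ_left hZ (hφ X) hY, A.φ_φ_of_horizontal hX, p_smul_mid] at t₂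
  rw [← A.p_φ_of_horizontal _ hX (hφ Y), A.φ_φ_of_horizontal hY, p_smul_right] at t₄
  rw [A.φ_φ_of_horizontal hZ, map_smul, smul_eq_mul, A.S_φ, p_neg_right,
    A.p_φ_of_horizontal X (hS Y) hZ] at u₁
  rw [A.φ_φ_of_horizontal hZ, map_smul, smul_eq_mul, A.S_φ, p_neg_right,
    A.p_φ_of_horizontal Y (hS X) hZ] at u₄
  rw [A.p_φ_left hY (hS X) hZ, A.p_φ_left hY hX (hS Z),
    ← A.p_φ_of_horizontal Y hX (hS Z)] at u₂
  rw [A.p_φ_left hX (hS Y) hZ, A.p_φ_left hX hY (hS Z),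
    ← A.p_φ_of_horizontal X hY (hS Z)] at u₃
  have h := A.p_cyc X Y (A.φ (A.S Z))
  rw [A.p_skew Y (A.φ (A.S Z)) X] at h
  apply A.two_cancel
  -- The right sides of `t₁`, `t₂`, `t₃`, `t₄` have reduced to `e`, `e`, `1`, `e` times `p Z X Y`,
  -- so they cancel in this combination.
  linear_combination 2 * h + t₁ + t₂ - A.e * t₃ - t₄ - u₁ - u₂ + u₃ + u₄

theorem p_S_left (X : 𝔛) {Y Z : 𝔛} (hY : A.g A.ξ Y = 0) (hZ : A.g A.ξ Z = 0) :
    A.p (A.S X) Y Z = 0 := by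
  have h := A.p_φ_S_left hY hZ (A.g_ξ_φ X)
  rw [A.S_φ, map_neg, A.φ_φ_of_horizontal (A.g_ξ_S X), p_neg_left, p_smul_left] at h
  linear_combination -A.e * h - A.p (A.S X) Y Z * A.e_mul_e

theorem p_ξ_mid (X Y : 𝔛) : A.p X A.ξ Y = A.g (A.φ (A.S X)) Y := by
  rw [p, A.g_symm, A.g_P_ξ]

theorem p_ξ_right (X Y : 𝔛) : A.p X Y A.ξ = -A.g (A.φ (A.S X)) Y := by
  rw [p_skew, p_ξ_mid]

theorem horizontal_sub (X : 𝔛) : A.g A.ξ (X - A.g A.ξ X • A.ξ) = 0 := by simp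

theorem p_eq (X Y Z : 𝔛) : A.p X Y Z =
    A.p X (Y - A.g A.ξ Y • A.ξ) (Z - A.g A.ξ Z • A.ξ) + A.g A.ξ Y * A.g (A.φ (A.S X)) Z
      - A.g A.ξ Z * A.g (A.φ (A.S X)) Y := by
  have h₁ := A.p_ξ_mid X Z
  have h₂ := A.p_ξ_right X Y
  have h₃ : A.p X A.ξ A.ξ = 0 := by rw [p_ξ_mid, g_φ_ξ]
  unfold p at *
  simp only [map_sub, map_smul, LinearMap.sub_apply, LinearMap.smul_apply, smul_eq_mul]
  rw [h₁, h₂, h₃]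
  ring

end ContactAlgebra

end ParaContact

/-! ### Second derivatives and isotropy of the skew part -/

namespace ParaContact
namespace ContactAlgebra

variable {R 𝔛 : Type*} [CommRing R] [AddCommGroup 𝔛] [Module R 𝔛] (A : ContactAlgebra R 𝔛)

/-- The covariant derivative of the tensor `P`. -/
def dP (V U Z : 𝔛) : 𝔛 := A.nab V (A.P U Z) - A.P (A.nab V U) Z - A.P U (A.nab V Z)

theorem nab_P (V U Z : 𝔛) :
    A.nab V (A.P U Z) = A.dP V U Z + A.P (A.nab V U) Z + A.P U (A.nab V Z) := by
  rw [dP]; abel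

/-- The Ricci identity for `φ`. -/
theorem dP_sub_dP (V U Z : 𝔛) : A.dP V U Z - A.dP U V Z =
    (A.e + A.k) • (A.g U (A.φ Z) • V - A.g V (A.φ Z) • U - A.g U Z • A.φ V + A.g V Z • A.φ U)
      + A.e • (A.g U Z • A.S V - A.g (A.S V) Z • U - A.g V Z • A.S U + A.g (A.S U) Z • V) := by
  have h₁ := A.curv_eq V U (A.φ Z)
  have h₂ := congrArg A.φ (A.curv_eq V U Z)
  have hL (V U : 𝔛) : A.nab V (A.nab U (A.φ Z)) = A.φ (A.nab V (A.nab U Z)) + A.P V (A.nab U Z)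
      - A.e • (A.g V (A.nab U Z) • A.ξ - A.g A.ξ (A.nab U Z) • V)
      + (A.dP V U Z + A.P (A.nab V U) Z + A.P U (A.nab V Z))
      - A.e • ((A.g (A.nab V U) Z + A.g U (A.nab V Z)) • A.ξ + A.g U Z • (A.S V - A.φ V)
        - (A.g (A.S V) Z + A.g V (A.φ Z) + A.g A.ξ (A.nab V Z)) • U
        -- Only the terms not symmetric in `V`, `U` survive the commutator; the derivatives of `P`
        -- contribute `dP V U Z - dP U V Z`.
        - A.g A.ξ Z • A.nab V U) := by
    rw [A.nab_φ U, map_sub, map_add, A.nab_φ V, A.nab_P, A.nab_smul, A.der_e, map_sub (A.nab V),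
      A.nab_smul, A.nab_smul, A.der_g, A.der_η, A.nab_ξ, A.g_φ]
    module
  rw [KoszulAlgebra.curv] at h₁ h₂
  rw [hL, hL, A.nab_φ] at h₁
  simp only [map_sub, map_smul, LinearMap.sub_apply, AddMonoidHom.sub_apply] at h₁ h₂
  linear_combination (norm := module) h₁ - h₂

/-- The scalar form of the covariant derivative of `P`. -/
def q (V U Z X : 𝔛) : R := A.g Z (A.dP V U X)

theorem der_p (V U Z X : 𝔛) : A.der V (A.p U Z X) =
    A.q V U Z X + A.p (A.nab V U) Z X + A.p U (A.nab V Z) X + A.p U Z (A.nab V X) := by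
  rw [p, A.der_g, A.nab_P, q, p, p, p, map_add, map_add]; ring

theorem q_skew (V U Z X : 𝔛) : A.q V U Z X = -A.q V U X Z := by
  have h : A.p U Z X + A.p U X Z = 0 := by rw [A.p_skew U Z X]; ring
  have h' := congrArg (A.der V) h
  rw [A.der_add, A.der_p, A.der_p, A.der_zero] at h'
  linear_combination h' - A.p_skew (A.nab V U) Z X - A.p_skew U (A.nab V Z) X
    - A.p_skew U (A.nab V X) Z

theorem q_cyc (V U Z X : 𝔛) : A.q V U Z X + A.q V Z X U + A.q V X U Z = 0 := by
  have h := congrArg (A.der V) (A.p_cyc U Z X)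
  rw [A.der_add, A.der_add, A.der_p, A.der_p, A.der_p, A.der_zero] at h
  linear_combination h - A.p_cyc (A.nab V U) Z X - A.p_cyc U (A.nab V Z) X
    - A.p_cyc U Z (A.nab V X)

@[simp] theorem q_smul_left (V U Z X : 𝔛) (f : R) : A.q V U (f • Z) X = f * A.q V U Z X := by
  simp [q]

theorem q_smul_right (V U Z X : 𝔛) (f : R) : A.q V U Z (f • X) = f * A.q V U Z X := by
  rw [q_skew, q_smul_left, A.q_skew V U Z X]; ring

/-- `s(X, Y) = g(S X, Y)`. -/
def s (X Y : 𝔛) : R := A.g (A.S X) Y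

/-- `w(X, Y) = g(φ S X, Y)`. -/
def w (X Y : 𝔛) : R := A.g (A.φ (A.S X)) Y

/-- The fundamental form. -/
def Φ (X Y : 𝔛) : R := A.g X (A.φ Y)

/-- The scalar product of two values of `P`. -/
def m (X Y Z W : 𝔛) : R := A.g (A.P X Y) (A.P Z W)

theorem s_symm (X Y : 𝔛) : A.s X Y = A.s Y X := by rw [s, s, A.g_S, A.g_symm]

theorem w_symm (X Y : 𝔛) : A.w X Y = A.w Y X := by
  rw [w, w, A.g_φ, A.g_S, A.S_φ, map_neg, neg_neg, A.g_symm]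

theorem m_symm (X Y Z W : 𝔛) : A.m X Y Z W = A.m Z W X Y := by rw [m, m, A.g_symm]

theorem Φ_skew (X Y : 𝔛) : A.Φ X Y = -A.Φ Y X := by rw [Φ, Φ, ← A.g_φ, A.g_symm]

/-- The quadratic terms in the derivative of the relation `P φ + φ P = 0` on horizontal fields. -/
def D (V U X Z : 𝔛) : R := A.m U X V Z + A.m U Z V X
  - A.e * (A.g V Z * A.w U X + A.g V X * A.w U Z)
  - A.e * (A.s U Z * (A.s V X + A.Φ V X) + (A.s V Z + A.Φ V Z) * A.s U X)

theorem q_φ (V U : 𝔛) {X Z : 𝔛} (hX : A.g A.ξ X = 0) (hZ : A.g A.ξ Z = 0) :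
    A.q V U X (A.φ Z) = A.q V U (A.φ X) Z + A.D V U X Z := by
  have hX' : A.g X A.ξ = 0 := by rw [A.g_symm, hX]
  have h₀ : A.P U (A.φ Z) + A.φ (A.P U Z) =
      -(A.e • (A.g (A.S U) Z • A.ξ)) - A.e • (A.g A.ξ Z • A.S U) := by
    rw [A.P_φ]; module
  have h := congrArg (fun Y ↦ A.g X (A.nab V Y)) h₀
  have h₁ := congrArg (A.g X) (A.P_φ (A.nab V U) Z)
  have h₂ := congrArg (A.g X) (A.P_φ U (A.nab V Z))
  have h₃ := A.P_skew U (A.P V Z) X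
  have h₄ := A.P_skew V (A.P U Z) X
  have h₅ : A.g A.ξ (A.P U Z) = A.w U Z := by rw [w, ← A.g_P_ξ, A.g_symm]
  simp only [map_add, map_sub, map_neg, A.nab_P, A.nab_φ, A.nab_smul, A.der_e, A.nab_ξ,
    map_smul, smul_eq_mul, zero_smul, zero_add, hX', hZ, mul_zero, h₅, P_right_ξ,
    sub_zero, smul_zero] at h h₁ h₂
  have h₆ := A.der_η V Z
  rw [hZ, A.der_zero] at h₆
  unfold q D m
  unfold w s Φ at *
  have e₁ := A.g_φ X (A.dP V U Z)
  have e₂ := A.g_φ V Z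
  have e₃ := A.g_φ V X
  linear_combination (norm := (simp only [A.g_symm]; ring1)) h - h₁ - h₂ - h₃ - h₄ - e₁
    + A.e * A.g (A.S U) X * (e₂ - h₆) + A.e * A.g (A.S U) Z * e₃

/-- The argument of `p_φ_left` one derivative higher: moving `φ` between the last two slots of `q`
is no longer free, and each move costs a term `D`. -/
theorem q_φ_left (V U : 𝔛) {Z X : 𝔛} (hU : A.g A.ξ U = 0) (hZ : A.g A.ξ Z = 0)
    (hX : A.g A.ξ X = 0) :
    2 * (A.q V (A.φ U) Z X - A.q V U (A.φ Z) X) =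
      A.D V U Z X + A.D V Z X U + A.D V X U Z - 2 * A.D V Z X U
      + A.e * (A.D V (A.φ U) Z (A.φ X) + A.D V (A.φ Z) X (A.φ U) + A.D V (A.φ X) U (A.φ Z)) := by
  have hφ (W : 𝔛) : A.g A.ξ (A.φ W) = 0 := A.g_ξ_φ W
  have b₁ := A.q_φ V U hZ hX
  have b₂ := A.q_φ V Z hX hU
  have b₃ := A.q_φ V X hU hZ
  have c₁ := A.q_cyc V (A.φ U) Z X
  have c₂ := A.q_cyc V U (A.φ Z) X
  have c₃ := A.q_cyc V U Z (A.φ X)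
  have c₄ := A.q_cyc V (A.φ U) (A.φ Z) (A.φ X)
  have d₁ := A.q_φ V (A.φ U) hZ (hφ X)
  have d₂ := A.q_φ V (A.φ Z) hX (hφ U)
  have d₃ := A.q_φ V (A.φ X) hU (hφ Z)
  rw [A.φ_φ_of_horizontal hX, q_smul_right] at d₁
  rw [A.φ_φ_of_horizontal hU, q_smul_right] at d₂
  rw [A.φ_φ_of_horizontal hZ, q_smul_right] at d₃
  linear_combination c₁ - c₂ - c₃ + A.e * (d₁ + d₂ + d₃) + A.e * c₄ + b₁ - b₂ + b₃
    - (A.q V (A.φ U) Z X + A.q V (A.φ Z) X U + A.q V (A.φ X) U Z) * A.e_mul_e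

theorem q_sub_q (hk : A.e + A.k = 0) (V U Z X : 𝔛) : A.q V U Z X - A.q U V Z X =
    A.e * (A.g U X * A.s V Z - A.s V X * A.g U Z - A.g V X * A.s U Z + A.s U X * A.g V Z) := by
  have h := congrArg (A.g Z) (A.dP_sub_dP V U X)
  rw [hk] at h
  simp only [map_add, map_sub, map_smul, smul_eq_mul, zero_smul, zero_add] at h
  unfold q s
  rw [h, A.g_symm (A.S V) Z, A.g_symm (A.S U) Z, A.g_symm U Z, A.g_symm V Z]

section
variable {X Y : 𝔛}

theorem s_φ (X Y : 𝔛) : A.s X (A.φ Y) = -A.w X Y := by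
  rw [s, w, A.g_φ, neg_neg]

theorem s_φ_left (X Y : 𝔛) : A.s (A.φ X) Y = -A.w X Y := by
  rw [s_symm, s_φ, w_symm]

theorem w_φ (X : 𝔛) (hY : A.g A.ξ Y = 0) : A.w X (A.φ Y) = -A.e * A.s X Y := by
  rw [s, w, A.g_φ_φ, hY]; ring

theorem w_φ_left (Y : 𝔛) (hX : A.g A.ξ X = 0) : A.w (A.φ X) Y = -A.e * A.s X Y := by
  rw [w_symm, A.w_φ Y hX, s_symm]

theorem Φ_φ (X : 𝔛) (hY : A.g A.ξ Y = 0) : A.Φ X (A.φ Y) = A.e * A.g X Y := by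
  rw [Φ, A.φ_φ_of_horizontal hY, map_smul, smul_eq_mul]

theorem g_φ_left (X Y : 𝔛) : A.g (A.φ X) Y = -A.Φ X Y := A.g_φ X Y

theorem g_φ_right (X Y : 𝔛) : A.g X (A.φ Y) = A.Φ X Y := rfl

theorem P_φ_left (hX : A.g A.ξ X = 0) (hY : A.g A.ξ Y = 0) :
    A.P (A.φ X) Y = A.P X (A.φ Y) := by
  refine A.ext_g fun Z ↦ ?_
  rw [A.g_symm, A.g_symm (A.P X _), ← p, ← p, p_eq, A.p_eq X]
  rw [hY, A.g_ξ_φ, zero_smul, sub_zero, sub_zero,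
    A.p_φ_left hX (A.horizontal_sub Z) hY, A.p_φ_of_horizontal X (A.horizontal_sub Z) hY,
    ← w, ← w, ← w, A.w_φ X hY, A.w_φ_left Y hX]
  ring

theorem P_φ_right (X : 𝔛) (hY : A.g A.ξ Y = 0) :
    A.P X (A.φ Y) = -A.φ (A.P X Y) - (A.e * A.s X Y) • A.ξ := by
  have h := A.P_φ X Y
  rw [hY] at h
  rw [s]
  linear_combination (norm := module) h

end

theorem m_φ_φ {U Z V X : 𝔛} (hU : A.g A.ξ U = 0) (hZ : A.g A.ξ Z = 0) (hX : A.g A.ξ X = 0) :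
    A.m (A.φ U) Z V (A.φ X) =
      -A.e * (A.m U Z V X - A.w U Z * A.w V X) + A.s U Z * A.s V X := by
  have h (X Y : 𝔛) : A.g A.ξ (A.P X Y) = A.w X Y := by rw [w, ← A.g_P_ξ, A.g_symm]
  rw [m, A.P_φ_left hU hZ, A.P_φ_right U hZ, A.P_φ_right V hX]
  simp only [map_sub, map_neg, map_smul, LinearMap.sub_apply, LinearMap.neg_apply,
    LinearMap.smul_apply, smul_eq_mul, g_φ_ξ, g_ξ_φ, g_ξ_ξ', A.g_φ_φ, h]
  rw [m]
  linear_combination A.s U Z * A.s V X * A.e_mul_e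

theorem m_φ_φ' {U Z V X : 𝔛} (hU : A.g A.ξ U = 0) (hX : A.g A.ξ X = 0) :
    A.m (A.φ U) (A.φ X) V Z = A.e * A.m U X V Z := by
  rw [m, A.P_φ_left hU (A.g_ξ_φ X), A.φ_φ_of_horizontal hX]
  simp [m]

/-- Removes `φ` from the error terms of `q_φ_left`, so that they can be compared with the untwisted
ones in `gray_bianchi`. -/
theorem D_φ (V : 𝔛) {U Z X : 𝔛} (hU : A.g A.ξ U = 0) (hZ : A.g A.ξ Z = 0)
    (hX : A.g A.ξ X = 0) : A.e * A.D V (A.φ U) Z (A.φ X) = A.m U X V Z - A.m U Z V X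
      + A.e * (A.s U Z * (A.s V X + A.Φ V X) - A.s U X * (A.s V Z + A.Φ V Z)
        + A.g V X * A.w U Z - A.g V Z * A.w U X) := by
  unfold D
  rw [A.m_φ_φ hU hZ hX, A.m_φ_φ' hU hX, A.w_φ_left _ hU, A.w_φ_left _ hU, A.s_φ, A.s_φ V, A.s_φ_left,
    A.s_φ_left, A.w_φ _ hX, A.Φ_φ V hX, A.g_φ_right]
  linear_combination (-A.m U Z V X + A.m U X V Z + A.Φ V X * A.s U Z * A.e + A.w U Z * A.w V X
    - A.e * A.g V Z * A.w U X - A.e * A.s U X * (A.s V Z + A.Φ V Z) - A.w U Z * A.w V X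
    + A.e * A.g V X * A.w U Z) * A.e_mul_e


/-- The skew part of `P` satisfies a quadratic Bianchi identity. -/
theorem gray_bianchi (hk : A.e + A.k = 0) {V U Z X : 𝔛} (hV : A.g A.ξ V = 0)
    (hU : A.g A.ξ U = 0) (hZ : A.g A.ξ Z = 0) (hX : A.g A.ξ X = 0) :
    (A.m U Z V X - A.m Z U V X - A.m U Z X V + A.m Z U X V)
    + (A.m Z X V U - A.m X Z V U - A.m Z X U V + A.m X Z U V)
    + (A.m X U V Z - A.m U X V Z - A.m X U Z V + A.m U X Z V) = 0 := by
  -- Start from the cyclic sum of `q (φ V) U Z X`, which is zero. Swap the first two slots (`u`),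
  -- move `φ` from `V` onto a later slot (`b`), and swap back (`v`); `d₁`, `d₂`, `d₃` show that the
  -- result is again zero up to terms `D`. What remains is quadratic, and the terms in `S` and `Φ`
  -- cancel.
  have b₁ := A.q_φ_left U V hV hZ hX
  have b₂ := A.q_φ_left Z V hV hX hU
  have b₃ := A.q_φ_left X V hV hU hZ
  have c := A.q_cyc (A.φ V) U Z X
  have u₁ := A.q_sub_q hk (A.φ V) U Z X
  have u₂ := A.q_sub_q hk (A.φ V) Z X U
  have u₃ := A.q_sub_q hk (A.φ V) X U Z
  have v₁ := A.q_sub_q hk V U (A.φ Z) X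
  have v₂ := A.q_sub_q hk V Z (A.φ X) U
  have v₃ := A.q_sub_q hk V X (A.φ U) Z
  have d₁ := A.q_φ_left V U hU hZ hX
  have d₂ := A.q_cyc V (A.φ U) Z X
  have d₃ := A.q_φ V Z hX hU
  simp only [mul_add, A.D_φ _ hU hZ hX, A.D_φ _ hZ hX hU, A.D_φ _ hX hU hZ, A.D_φ _ hV hZ hX,
    A.D_φ _ hV hX hU, A.D_φ _ hV hU hZ, A.D_φ _ hZ hX hV, A.D_φ _ hX hV hZ, A.D_φ _ hX hU hV,
    A.D_φ _ hU hV hX, A.D_φ _ hU hZ hV, A.D_φ _ hZ hV hU, s_φ, s_φ_left, g_φ_left, g_φ_right]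
    at b₁ b₂ b₃ u₁ u₂ u₃ v₁ v₂ v₃ d₁
  unfold D at *
  simp only [A.Φ_skew U V, A.Φ_skew Z V, A.Φ_skew X V, A.Φ_skew Z U, A.Φ_skew X U, A.Φ_skew X Z]
    at *
  apply A.two_cancel
  linear_combination (norm := (simp only [A.m_symm, A.w_symm, A.s_symm, A.g_symm]; ring1))
    -b₁ - b₂ - b₃ + 2 * c - 2 * (u₁ + u₂ + u₃) + 2 * (v₁ + v₂ + v₃)
    + d₁ - 2 * d₂ + 2 * d₃

/-- The skew part of `P`. -/
def T (X Y : 𝔛) : 𝔛 := A.P X Y - A.P Y X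

/-- The cyclic identity moves the first slot of `P` into a scalar product, so a sum over that slot
becomes a scalar product of two values of `T`. -/
theorem g_T (X Y Z : 𝔛) : A.g Z (A.T X Y) = A.p Z X Y := by
  have h := A.p_cyc X Y Z
  have h' := A.p_skew X Y Z
  rw [T, map_sub]
  unfold p at *
  linear_combination h' - h

theorem T_φ {X Y : 𝔛} (hX : A.g A.ξ X = 0) (hY : A.g A.ξ Y = 0) :
    A.T X (A.φ Y) = A.T (A.φ X) Y := by
  refine A.ext_g fun Z ↦ ?_
  rw [A.g_symm, A.g_T, A.g_symm, A.g_T, A.p_φ_of_horizontal Z hX hY]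

theorem T_φ_left {X Y : 𝔛} (hX : A.g A.ξ X = 0) (hY : A.g A.ξ Y = 0) :
    A.T (A.φ X) Y = -A.φ (A.T X Y) := by
  refine A.ext_g fun Z ↦ ?_
  rw [A.g_symm, A.g_T, A.g_symm, map_neg, ← A.g_φ, A.g_T]
  have h := A.p_φ_left (A.horizontal_sub Z) hX hY
  unfold p at *
  simpa using h.symm

theorem T_smul_left (X Y : 𝔛) (f : R) : A.T (f • X) Y = f • A.T X Y := by
  simp [T, smul_sub]

theorem g_T_φ_T_φ {X Y Z W : 𝔛} (hX : A.g A.ξ X = 0) (hY : A.g A.ξ Y = 0) (hZ : A.g A.ξ Z = 0)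
    (hW : A.g A.ξ W = 0) :
    A.g (A.T (A.φ X) Y) (A.T Z (A.φ W)) = -A.e * A.g (A.T X Y) (A.T Z W) := by
  rw [A.T_φ hZ hW, A.T_φ_left hX hY, A.T_φ_left hZ hW]
  simp only [map_neg, LinearMap.neg_apply, neg_neg]
  rw [A.g_φ_φ, A.g_T X Y A.ξ, p_ξ_left, zero_mul, sub_zero]

/-- The quadratic curvature identity on horizontal fields. -/
theorem g_T_T_of_horizontal (hk : A.e + A.k = 0) {V U Z X : 𝔛} (hV : A.g A.ξ V = 0)
    (hU : A.g A.ξ U = 0) (hZ : A.g A.ξ Z = 0) (hX : A.g A.ξ X = 0) :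
    A.g (A.T X U) (A.T V Z) = 0 := by
  have h {V U Z X : 𝔛} (hV : A.g A.ξ V = 0) (hU : A.g A.ξ U = 0) (hZ : A.g A.ξ Z = 0)
      (hX : A.g A.ξ X = 0) : A.g (A.T U Z) (A.T V X) + A.g (A.T Z X) (A.T V U)
        + A.g (A.T X U) (A.T V Z) = 0 := by
    have := A.gray_bianchi hk hV hU hZ hX
    unfold m at this
    simp only [T, map_sub, LinearMap.sub_apply]
    linear_combination this
  have h₁ := h hV hU hZ hX
  -- With `φ U`, `φ X` in place of `U`, `X`, the first two terms are multiplied by `-e` and the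
  -- third by `e`. Comparison with `h₁` isolates the third.
  have h₂ := h hV (A.g_ξ_φ U) hZ (A.g_ξ_φ X)
  rw [A.g_T_φ_T_φ hU hZ hV hX, A.T_φ hZ hX, A.g_T_φ_T_φ hZ hX hV hU,
    A.T_φ (A.g_ξ_φ X) hU, A.φ_φ_of_horizontal hX, T_smul_left, map_smul, LinearMap.smul_apply,
    smul_eq_mul] at h₂
  apply A.two_cancel
  linear_combination h₁ + A.e * h₂ + (A.g (A.T U Z) (A.T V X) + A.g (A.T Z X) (A.T V U)
    - A.g (A.T X U) (A.T V Z)) * A.e_mul_e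

theorem T_eq (X Y : 𝔛) : A.T X Y = A.T (X - A.g A.ξ X • A.ξ) (Y - A.g A.ξ Y • A.ξ)
    - A.g A.ξ X • A.S (A.φ Y) + A.g A.ξ Y • A.S (A.φ X) := by
  refine A.ext_g fun Z ↦ ?_
  rw [A.g_symm, A.g_T, A.g_symm, map_add, map_sub, A.g_T, map_smul, map_smul, A.p_eq,
    A.g_φ, A.g_φ, A.g_S, A.g_S, smul_eq_mul, smul_eq_mul]
  ring

/-- The skew part of `P` has totally isotropic image if `k = -e`. -/
theorem g_T_T (hk : A.e + A.k = 0) (X Y Z W : 𝔛) : A.g (A.T X Y) (A.T Z W) = 0 := by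
  have hS (X Y U : 𝔛) : A.g (A.S U) (A.T (X - A.g A.ξ X • A.ξ) (Y - A.g A.ξ Y • A.ξ)) = 0 := by
    rw [A.g_T, A.p_S_left _ (A.horizontal_sub X) (A.horizontal_sub Y)]
  have hSS (U V : 𝔛) : A.g (A.S U) (A.S V) = 0 := by
    rw [← A.g_S, A.S_S, hk, zero_smul, neg_zero, map_zero, LinearMap.zero_apply]
  have h := A.g_T_T_of_horizontal hk (A.horizontal_sub Z) (A.horizontal_sub Y)
    (A.horizontal_sub W) (A.horizontal_sub X)
  have hS' (X Y U : 𝔛) := (A.g_symm _ _).trans (hS X Y U)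
  rw [A.T_eq X Y, A.T_eq Z W]
  simp only [map_add, map_sub, map_smul, LinearMap.add_apply, LinearMap.sub_apply,
    LinearMap.smul_apply, smul_eq_mul] at hS hS' h ⊢
  simp only [hSS, hS, hS', h]
  ring

/-! ### The case `k ≠ -e` -/

theorem P_eq_of_isUnit (h : IsUnit (A.e + A.k)) (X Z : 𝔛) :
    A.P X Z = A.w X Z • A.ξ - A.g A.ξ Z • A.φ (A.S X) := by
  have h₀ {Y Z : 𝔛} (hY : A.g A.ξ Y = 0) (hZ : A.g A.ξ Z = 0) : A.p X Y Z = 0 := by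
    -- `P` vanishes on the image of `S²`, which is a unit multiple of the horizontal projection, and
    -- `P ξ = 0`.
    have := A.p_S_left (A.S X) hY hZ
    rw [A.S_S, p_neg_left, p_smul_left] at this
    have h' : A.p (X - A.g A.ξ X • A.ξ) Y Z = A.p X Y Z := by simp [p]
    rw [h', neg_eq_zero] at this
    exact h.mul_right_eq_zero.1 this
  refine A.ext_g fun Y ↦ ?_
  rw [A.g_symm, ← p, p_eq, h₀ (A.horizontal_sub Y) (A.horizontal_sub Z)]
  simp only [map_sub, map_smul, LinearMap.sub_apply, LinearMap.smul_apply, smul_eq_mul, w]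
  ring

/-- The Ricci identity for `φ`, if `k ≠ -e`. -/
theorem ricci_of_isUnit (h : IsUnit (A.e + A.k)) (V U : 𝔛) {Z W : 𝔛} (hZ : A.g A.ξ Z = 0)
    (hW : A.g A.ξ W = 0) :
    A.w U Z * (A.s V W + A.Φ V W) - (A.s V Z + A.Φ V Z) * A.w U W
      - A.w V Z * (A.s U W + A.Φ U W) + (A.s U Z + A.Φ U Z) * A.w V W =
    (A.e + A.k) * (A.Φ U Z * A.g V W - A.Φ V Z * A.g U W + A.g U Z * A.Φ V W - A.g V Z * A.Φ U W)
      + A.e * (A.g U Z * A.s V W - A.s V Z * A.g U W - A.g V Z * A.s U W + A.s U Z * A.g V W) := by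
  have hd (V U : 𝔛) : A.g (A.dP V U Z) W =
      A.w U Z * (A.s V W + A.Φ V W) - (A.s V Z + A.Φ V Z) * A.w U W := by
    have h₆ := A.der_η V Z
    rw [hZ, A.der_zero] at h₆
    rw [dP, A.P_eq_of_isUnit h, A.P_eq_of_isUnit h, A.P_eq_of_isUnit h, map_sub (A.nab V),
      A.nab_smul, A.nab_smul, hZ, A.der_zero, A.nab_ξ]
    simp only [map_sub, map_add, map_smul, LinearMap.sub_apply, LinearMap.add_apply,
      LinearMap.smul_apply, smul_eq_mul, hW, zero_smul, mul_zero, map_zero, LinearMap.zero_apply]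
    unfold s Φ w
    linear_combination A.g (A.φ (A.S U)) W * (A.g_φ V Z - h₆) - A.g (A.φ (A.S U)) Z * A.g_φ V W
  have h₁ := congrArg (fun Y ↦ A.g Y W) (A.dP_sub_dP V U Z)
  simp only [map_sub, map_add, map_smul, LinearMap.sub_apply, LinearMap.add_apply,
    LinearMap.smul_apply, smul_eq_mul, hd, A.g_φ] at h₁
  rw [← Φ, ← Φ, ← Φ, ← Φ, ← s, ← s, ← s, ← s] at h₁
  linear_combination h₁

end ContactAlgebra
end ParaContact

namespace ParaContact

/-! ### Curvature-like tensors and nondegenerate planes -/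

section Sectional

/-- The product of the two quadratics vanishes identically and the second is not zero, so the first
is the zero polynomial. This replaces a density argument for nondegenerate planes. -/
theorem eq_zero_of_quadratic {a b c a' b' c' : ℝ} (hc : c' ≠ 0)
    (h : ∀ t : ℝ, a' + b' * t + c' * t ^ 2 ≠ 0 → a + b * t + c * t ^ 2 = 0) : a = 0 := by
  open Polynomial in
  have hpq : (C a' + C b' * X + C c' * X ^ 2) * (C a + C b * X + C c * X ^ 2) = (0 : ℝ[X]) := by
    refine Polynomial.funext fun t ↦ ?_
    simp only [eval_mul, eval_add, eval_C, eval_X, eval_pow, eval_zero]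
    by_cases ht : a' + b' * t + c' * t ^ 2 = 0
    · rw [ht, zero_mul]
    · rw [h t ht, mul_zero]
  rcases mul_eq_zero.mp hpq with hp | hp
  · have := congrArg (Polynomial.coeff · 2) hp
    simp at this
    exact absurd this hc
  · simpa using congrArg (Polynomial.eval 0) hp

variable {V : Type*} [AddCommGroup V] [Module ℝ V]

/-- A curvature-like tensor vanishes if it vanishes on the nondegenerate planes of a bilinear form,
provided that there is a nondegenerate plane. -/
theorem eq_zero_of_nondegenerate_planes (K : V → V → V → V → ℝ) (G : V →ₗ[ℝ] V →ₗ[ℝ] ℝ)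
    (add : ∀ X X' Y Z W, K (X + X') Y Z W = K X Y Z W + K X' Y Z W)
    (smul : ∀ (t : ℝ) X Y Z W, K (t • X) Y Z W = t * K X Y Z W)
    (skew : ∀ X Y Z W, K X Y Z W = -K Y X Z W) (skew' : ∀ X Y Z W, K X Y Z W = -K X Y W Z)
    (bianchi : ∀ X Y Z W, K X Y Z W + K Y Z X W + K Z X Y W = 0)
    (symm : ∀ X Y, G X Y = G Y X) {X₀ Y₀ : V} (h₀ : G X₀ X₀ * G Y₀ Y₀ - G X₀ Y₀ ^ 2 ≠ 0)
    (h : ∀ X Y, G X X * G Y Y - G X Y ^ 2 ≠ 0 → K X Y Y X = 0) (X Y Z W : V) :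
    K X Y Z W = 0 := by
  have pair (X Y Z W) : K X Y Z W = K Z W X Y := by
    linarith [bianchi X Y Z W, bianchi Y Z W X, bianchi Z W X Y, bianchi W X Y Z,
      skew X Y Z W, skew X Y W Z, skew Y Z X W, skew Y Z W X, skew Z W X Y, skew Z W Y X,
      skew W X Y Z, skew W X Z Y, skew Z X Y W, skew Z X W Y, skew Y W X Z, skew Y W Z X,
      skew' X Y Z W, skew' Y X Z W, skew' Y Z X W, skew' Z Y X W, skew' Z W X Y, skew' W Z X Y,
      skew' W X Y Z, skew' X W Y Z, skew' Z X Y W, skew' X Z Y W, skew' Y W X Z, skew' W Y X Z]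
  have add₂ (X Y Y' Z W) : K X (Y + Y') Z W = K X Y Z W + K X Y' Z W := by
    rw [skew, add, skew Y, skew Y']; ring
  have add₃ (X Y Z Z' W) : K X Y (Z + Z') W = K X Y Z W + K X Y Z' W := by
    rw [pair, add, pair Z, pair Z']
  have add₄ (X Y Z W W') : K X Y Z (W + W') = K X Y Z W + K X Y Z W' := by
    rw [pair, add₂, pair Z, pair Z]
  have smul₂ (t : ℝ) (X Y Z W) : K X (t • Y) Z W = t * K X Y Z W := by
    rw [skew, smul, skew Y]; ring
  have smul₃ (t : ℝ) (X Y Z W) : K X Y (t • Z) W = t * K X Y Z W := by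
    rw [pair, smul, pair Z]
  have smul₄ (t : ℝ) (X Y Z W) : K X Y Z (t • W) = t * K X Y Z W := by
    rw [pair, smul₂, pair Z]
  -- Move `X` along `X₀`: the Gram determinant of `X + t X₀` and `Y` has leading coefficient `hY`.
  -- In `h₂` the field `Y` is moved along `Y₀` in the same way, which removes `hY`.
  have h₁ (X) {Y} (hY : G X₀ X₀ * G Y Y - G X₀ Y ^ 2 ≠ 0) : K X Y Y X = 0 := by
    refine eq_zero_of_quadratic (b := K X Y Y X₀ + K X₀ Y Y X) (c := K X₀ Y Y X₀)
      (a' := G X X * G Y Y - G X Y ^ 2) (b' := 2 * (G X X₀ * G Y Y - G X Y * G X₀ Y)) hY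
      fun t ht ↦ ?_
    have := h (X + t • X₀) Y fun h' ↦ ht ?_
    · simp only [add, smul, add₄, smul₄] at this
      linear_combination this
    · simp only [map_add, map_smul, LinearMap.add_apply, LinearMap.smul_apply, smul_eq_mul] at h'
      linear_combination h' - t * G Y Y * symm X₀ X
  have h₂ (X Y) : K X Y Y X = 0 := by
    refine eq_zero_of_quadratic (b := K X Y Y₀ X + K X Y₀ Y X) (c := K X Y₀ Y₀ X)
      (a' := G X₀ X₀ * G Y Y - G X₀ Y ^ 2) (b' := 2 * (G X₀ X₀ * G Y Y₀ - G X₀ Y * G X₀ Y₀)) h₀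
      fun t ht ↦ ?_
    have := h₁ X (Y := Y + t • Y₀) fun h' ↦ ht ?_
    · simp only [add₂, smul₂, add₃, smul₃] at this
      linear_combination this
    · simp only [map_add, map_smul, LinearMap.add_apply, LinearMap.smul_apply, smul_eq_mul] at h'
      linear_combination h' - t * G X₀ X₀ * symm Y₀ Y
  -- Polarization in the middle and outer pairs makes `K` skew in all arguments, and the Bianchi
  -- identity then kills it.
  have h₃ (X Y Z) : K X Y Z X = 0 := by
    have := h₂ X (Y + Z)
    rw [add₂, add₃, add₃, h₂, h₂] at this
    linarith [pair X Z Y X, skew Y X X Z, skew' X Y X Z]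
  have h₄ (X Y Z W) : K X Y Z W = -K W Y Z X := by
    have := h₃ (X + W) Y Z
    rw [add, add₄, add₄, h₃, h₃] at this
    linarith
  linarith [bianchi X Y Z W, h₄ Y Z X W, h₄ Z X Y W, skew W Z X Y, skew' Z W X Y,
    h₄ Z W Y X, h₄ W X Y Z, skew' Z X Y W, skew Z X W Y, h₄ X Z W Y, skew Y Z X W, skew' Z Y X W,
    h₄ Z Y W X, skew X Y W Z, skew' Y X W Z, h₄ X Y W Z, skew' X Y Z W, skew Z Y W X, skew' Y Z W X,
    skew Y Z W X]

end Sectional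

/-! ### Contractions over an orthonormal basis -/

section Trace

variable {V : Type*} [AddCommGroup V] [Module ℝ V] {ι : Type*} [Fintype ι]

/-- A family of vectors with `G(Eᵢ, Eⱼ) = ± δᵢⱼ`, as many as the dimension. -/
structure IsOrthonormalBasis (G : V →ₗ[ℝ] V →ₗ[ℝ] ℝ) (E : ι → V) : Prop where
  sq (i : ι) : G (E i) (E i) = 1 ∨ G (E i) (E i) = -1
  orthogonal (i j : ι) (h : i ≠ j) : G (E i) (E j) = 0
  card : Fintype.card ι = Module.finrank ℝ V

namespace IsOrthonormalBasis

variable {G : V →ₗ[ℝ] V →ₗ[ℝ] ℝ} {E : ι → V}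

theorem sq_mul_sq (hE : IsOrthonormalBasis G E) (i : ι) : G (E i) (E i) * G (E i) (E i) = 1 := by
  rcases hE.sq i with h | h <;> rw [h] <;> norm_num

theorem sum_apply (hE : IsOrthonormalBasis G E) (c : ι → ℝ) (j : ι) :
    G (∑ i, c i • E i) (E j) = c j * G (E j) (E j) := by
  simp only [map_sum, map_smul, LinearMap.sum_apply, LinearMap.smul_apply, smul_eq_mul]
  exact Finset.sum_eq_single j (fun i _ hij ↦ by rw [hE.orthogonal i j hij, mul_zero]) (by simp)

theorem linearIndependent (hE : IsOrthonormalBasis G E) : LinearIndependent ℝ E := by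
  refine Fintype.linearIndependent_iff.mpr fun c hc j ↦ ?_
  have h := hE.sum_apply c j
  rw [hc, map_zero, LinearMap.zero_apply] at h
  linear_combination -c j * hE.sq_mul_sq j - G (E j) (E j) * h

/-- An orthonormal basis as a basis. -/
noncomputable def basis [Nonempty ι] (hE : IsOrthonormalBasis G E) : Module.Basis ι ℝ V :=
  basisOfLinearIndependentOfCardEqFinrank hE.linearIndependent hE.card

variable [Nonempty ι]

theorem basis_apply (hE : IsOrthonormalBasis G E) (i : ι) : hE.basis i = E i := by
  simp [basis]

theorem repr_apply (hE : IsOrthonormalBasis G E) (x : V) (i : ι) :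
    hE.basis.repr x i = G (E i) (E i) * G x (E i) := by
  have h := hE.sum_apply (hE.basis.repr x) i
  simp only [← hE.basis_apply, hE.basis.sum_repr] at h ⊢
  have := hE.sq_mul_sq i
  rw [← hE.basis_apply] at this
  rw [h]
  linear_combination -hE.basis.repr x i * this

theorem sum_mul (hE : IsOrthonormalBasis G E) (symm : ∀ x y, G x y = G y x) (x y : V) :
    ∑ i, G (E i) (E i) * (G (E i) x * G (E i) y) = G x y := by
  conv_rhs => rw [← hE.basis.sum_repr x]
  simp only [map_sum, map_smul, LinearMap.sum_apply, LinearMap.smul_apply, smul_eq_mul,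
    hE.repr_apply, hE.basis_apply, symm x]
  exact Finset.sum_congr rfl fun i _ ↦ by ring

theorem trace_eq (hE : IsOrthonormalBasis G E) (L : V →ₗ[ℝ] V) :
    LinearMap.trace ℝ V L = ∑ i, G (E i) (E i) * G (L (E i)) (E i) := by
  classical
  rw [LinearMap.trace_eq_matrix_trace ℝ hE.basis]
  simp [Matrix.trace, LinearMap.toMatrix_apply, hE.repr_apply, hE.basis_apply]

end IsOrthonormalBasis

/-- The Ricci identity of a (para)contact metric structure of constant curvature `k ≠ -e`
fails in dimension at least `5`, by a contraction. -/
theorem false_of_ricci [Nonempty ι] {G : V →ₗ[ℝ] V →ₗ[ℝ] ℝ} {E : ι → V}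
    (hE : IsOrthonormalBasis G E) (hι : 3 < Fintype.card ι) {φ S : V →ₗ[ℝ] V} {ξ : V} {e c : ℝ}
    (hc : c ≠ 0) (he : e * e = 1) (symm : ∀ x y, G x y = G y x) (g_ξ : G ξ ξ = 1)
    (φ_φ : ∀ x, φ (φ x) = e • (x - G ξ x • ξ)) (φ_ξ : φ ξ = 0) (g_φ : ∀ x y, G (φ x) y = -G x (φ y))
    (g_S : ∀ x y, G (S x) y = G x (S y)) (S_ξ : S ξ = 0) (S_φ : ∀ x, S (φ x) = -φ (S x))
    (ricci : ∀ V U Z W, G ξ Z = 0 → G ξ W = 0 →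
      G (φ (S U)) Z * (G (S V) W + G V (φ W)) - (G (S V) Z + G V (φ Z)) * G (φ (S U)) W
        - G (φ (S V)) Z * (G (S U) W + G U (φ W)) + (G (S U) Z + G U (φ Z)) * G (φ (S V)) W =
      c * (G U (φ Z) * G V W - G V (φ Z) * G U W + G U Z * G V (φ W) - G V Z * G U (φ W))
        + e * (G U Z * G (S V) W - G (S V) Z * G U W - G V Z * G (S U) W + G (S U) Z * G V W)) :
    False := by
  have hξS (x) : G ξ (S x) = 0 := by rw [← g_S, S_ξ, map_zero, LinearMap.zero_apply]
  have hξφ (x) : G ξ (φ x) = 0 := by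
    have := g_φ ξ x
    rw [φ_ξ, map_zero, LinearMap.zero_apply] at this
    linarith
  -- Both traces vanish because `φ` and `S` anticommute: `tr (φ S) = tr (S φ)`, and likewise for `S
  -- = e φ² S`.
  have tr₁ : ∑ i, G (E i) (E i) * G (φ (S (E i))) (E i) = 0 := by
    have h₁ := hE.trace_eq (φ * S)
    have h₂ := LinearMap.trace_mul_comm ℝ φ S
    have h₃ : S * φ = -(φ * S) := LinearMap.ext S_φ
    rw [h₃, map_neg] at h₂
    simp only [Module.End.mul_apply] at h₁
    linarith
  have tr₀ : ∑ i, G (E i) (E i) * G (S (E i)) (E i) = 0 := by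
    have h₁ := hE.trace_eq S
    have h₂ := LinearMap.trace_mul_comm ℝ φ (φ * S)
    have h₃ : φ * S * φ = -(φ * (φ * S)) := LinearMap.ext fun x ↦ by simp [S_φ]
    have h₄ : S = e • (φ * (φ * S)) := LinearMap.ext fun x ↦ by
      simp [φ_φ, hξS, smul_smul, he]
    rw [h₃, map_neg] at h₂
    rw [← h₁, h₄, map_smul, smul_eq_mul]
    linear_combination e / 2 * h₂
  have hsum : ∑ i, G (E i) (E i) * (G (E i) (E i) - G ξ (E i) * G ξ (E i)) =
      Fintype.card ι - 1 := by
    simp only [mul_sub, hE.sq_mul_sq, Finset.sum_sub_distrib, symm ξ, hE.sum_mul symm, g_ξ]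
    simp
  have hcard : (3 : ℝ) < Fintype.card ι := by exact_mod_cast hι
  -- The Ricci identity is contracted over `V = W`, taken to be the horizontal part of each `E i`.
  -- The projection has trace `dim - 1`, and the other terms lower the factor to `dim - 3`.
  have key (U Z) (hU : G ξ U = 0) (hZ : G ξ Z = 0) : c * G U (φ Z) + e * G (S U) Z = 0 := by
    have hi (i) : 0 = G (φ (S U)) Z * (G (E i) (E i) * G (S (E i)) (E i))
        + (G (S U) Z + G U (φ Z)) * (G (E i) (E i) * G (φ (S (E i))) (E i))
        - (c * G U (φ Z) + e * G (S U) Z) *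
          (G (E i) (E i) * (G (E i) (E i) - G ξ (E i) * G ξ (E i)))
        - e * G U Z * (G (E i) (E i) * G (S (E i)) (E i))
        - G (E i) (E i) * (G (E i) (S Z) * G (E i) (φ (S U)))
        - G (E i) (E i) * (G (E i) (φ Z) * G (E i) (φ (S U)))
        + G (E i) (E i) * (G (E i) (S (φ Z)) * G (E i) (S U))
        - G (E i) (E i) * (G (E i) (S (φ Z)) * G (E i) (φ U))
        + c * (G (E i) (E i) * (G (E i) (φ Z) * G (E i) U))
        - c * (G (E i) (E i) * (G (E i) Z * G (E i) (φ U)))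
        + e * (G (E i) (E i) * (G (E i) (S Z) * G (E i) U))
        + e * (G (E i) (E i) * (G (E i) Z * G (E i) (S U))) := by
      have h := ricci (E i - G ξ (E i) • ξ) U Z (E i - G ξ (E i) • ξ) hZ (by simp [g_ξ])
      have h₀ : G (E i) (φ (E i)) = 0 := by
        have := g_φ (E i) (E i)
        rw [symm] at this
        linarith
      have h₁ : G (φ (S (E i))) Z = -G (E i) (S (φ Z)) := by rw [g_φ, g_S]
      simp only [map_sub, map_smul, LinearMap.sub_apply, LinearMap.smul_apply, smul_eq_mul, S_ξ,
        φ_ξ, hξφ, hξS, g_ξ, hU, hZ, symm _ ξ, map_zero, LinearMap.zero_apply, mul_zero, sub_zero, h₀, h₁,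
        symm U (E i), symm (φ (S U)) (E i), symm (S U) (E i)] at h
      rw [symm U (φ (E i)), g_φ (E i) U, g_S (E i) Z] at h
      linear_combination -G (E i) (E i) * h
    have h := Finset.sum_congr (rfl : (Finset.univ : Finset ι) = Finset.univ) fun i _ ↦ hi i
    simp only [Finset.sum_add_distrib, Finset.sum_sub_distrib, ← Finset.mul_sum, hE.sum_mul symm,
      tr₀, tr₁, hsum, Finset.sum_const_zero, mul_zero] at h
    have h₁ : G (S (φ Z)) (S U) = G (S Z) (φ (S U)) := by
      rw [S_φ, map_neg, LinearMap.neg_apply, g_φ, neg_neg]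
    have h₂ : G (S (φ Z)) (φ U) = -G (φ Z) (φ (S U)) := by
      rw [g_S, S_φ, map_neg]
    have h₃ : G Z (φ U) = -G U (φ Z) := by rw [symm, g_φ]
    rw [h₁, h₂, h₃, symm (φ Z) U, symm Z (S U), g_S Z U, symm Z (S U)] at h
    refine (mul_eq_zero.mp (?_ : ((Fintype.card ι : ℝ) - 3) * _ = 0)).resolve_left (by linarith)
    linear_combination h
  -- In `key` the first term is skew in `U`, `Z` and the second symmetric, so each vanishes. Then
  -- `φ` is zero on horizontal vectors, which are all isotropic, against the trace `hsum`.
  have hφ (U Z) (hU : G ξ U = 0) (hZ : G ξ Z = 0) : G U (φ Z) = 0 := by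
    have h₁ := key U Z hU hZ
    have h₂ := key Z U hZ hU
    rw [symm Z, g_φ, g_S, symm Z] at h₂
    refine (mul_eq_zero.mp ?_).resolve_left hc
    linear_combination (h₁ - h₂) / 2
  have hg (x) (hx : G ξ x = 0) : G x x = 0 := by
    have := hφ x (φ x) hx (hξφ x)
    rw [φ_φ, hx, zero_smul, sub_zero, map_smul, smul_eq_mul] at this
    linear_combination e * this - G x x * he
  rw [Finset.sum_eq_zero] at hsum
  · linarith
  · intro i _
    have := hg (E i - G ξ (E i) • ξ) (by simp [g_ξ])
    simp only [map_sub, map_smul, LinearMap.sub_apply, LinearMap.smul_apply, smul_eq_mul, g_ξ,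
      symm _ ξ] at this
    linear_combination G (E i) (E i) * this

end Trace

end ParaContact

namespace ParaContact

/-! ### Smooth functions and fields on a manifold -/

section SmoothFields

variable {E : Type*} [NormedAddCommGroup E] [NormedSpace ℝ E]
  {M : Type*} [TopologicalSpace M] [ChartedSpace E M] [IsManifold 𝓘(ℝ, E) ∞ M]

theorem VField.SmoothAt.diffAt {X : VField E M} {p : M} (h : X.SmoothAt p) : X.DiffAt p :=
  ContMDiffAt.mdifferentiableAt h (by simp)

theorem contMDiffAt_clm_apply {η : OneForm E M} {X : VField E M} {p : M}
    (hη : ContMDiffAt 𝓘(ℝ, E) (𝓘(ℝ, E).prod 𝓘(ℝ, E →L[ℝ] ℝ)) ∞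
      (fun p ↦ TotalSpace.mk' (E →L[ℝ] ℝ)
        (E := fun p : M ↦ TangentSpace 𝓘(ℝ, E) p →L[ℝ] ℝ) p (η p)) p)
    (hX : X.SmoothAt p) : ContMDiffAt 𝓘(ℝ, E) 𝓘(ℝ) ∞ (fun q ↦ η q (X q)) p := by
  have : ContMDiffAt 𝓘(ℝ, E) (𝓘(ℝ, E).prod 𝓘(ℝ)) ∞
      (fun m ↦ TotalSpace.mk' ℝ (E := Bundle.Trivial M ℝ) m (η m (X m))) p := by
    apply ContMDiffAt.clm_bundle_apply (F₁ := E)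
    · exact hη
    · exact hX
  simp only [contMDiffAt_totalSpace] at this
  exact this.2

theorem PseudoMetric.contMDiffAt (g : PseudoMetric E M) {X Y : VField E M} {p : M}
    (hX : X.SmoothAt p) (hY : Y.SmoothAt p) :
    ContMDiffAt 𝓘(ℝ, E) 𝓘(ℝ) ∞ (fun q ↦ g.val q (X q) (Y q)) p := by
  have : ContMDiffAt 𝓘(ℝ, E) (𝓘(ℝ, E).prod 𝓘(ℝ)) ∞
      (fun m ↦ TotalSpace.mk' ℝ (E := Bundle.Trivial M ℝ) m (g.val m (X m) (Y m))) p := by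
    apply ContMDiffAt.clm_bundle_apply₂ (F₁ := E) (F₂ := E)
    · exact g.smooth.contMDiffAt
    · exact hX
    · exact hY
  simp only [contMDiffAt_totalSpace] at this
  exact this.2

theorem VField.SmoothAt.end_apply {φ : EndField E M} {X : VField E M} {p : M}
    (hφ : ContMDiffAt 𝓘(ℝ, E) (𝓘(ℝ, E).prod 𝓘(ℝ, E →L[ℝ] E)) ∞
      (fun p ↦ TotalSpace.mk' (E →L[ℝ] E)
        (E := fun p : M ↦ TangentSpace 𝓘(ℝ, E) p →L[ℝ] TangentSpace 𝓘(ℝ, E) p) p (φ p)) p)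
    (hX : X.SmoothAt p) : VField.SmoothAt (E := E) (M := M) (fun q ↦ φ q (X q)) p :=
  ContMDiffAt.clm_bundle_apply hφ hX

theorem VField.SmoothAt.add {X Y : VField E M} {p : M} (hX : X.SmoothAt p) (hY : Y.SmoothAt p) :
    VField.SmoothAt (X + Y) p := ContMDiffAt.add_section hX hY

theorem VField.SmoothAt.smul {f : M → ℝ} {X : VField E M} {p : M}
    (hf : ContMDiffAt 𝓘(ℝ, E) 𝓘(ℝ) ∞ f p) (hX : X.SmoothAt p) :
    VField.SmoothAt (f • X) p := ContMDiffAt.smul_section hf hX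

variable (E M) in
/-- The algebra of smooth functions on `M`. -/
def smoothFunctions : Subalgebra ℝ (M → ℝ) where
  carrier := {f | ContMDiff 𝓘(ℝ, E) 𝓘(ℝ) ∞ f}
  mul_mem' hf hg := hf.mul hg
  add_mem' hf hg := hf.add hg
  algebraMap_mem' _ := contMDiff_const

variable (E M) in
/-- The module of smooth vector fields on `M`. -/
def smoothFields : Submodule (smoothFunctions E M) (VField E M) where
  carrier := {X | ∀ p, X.SmoothAt p}
  add_mem' hX hY p := (hX p).add (hY p)
  zero_mem' p := contMDiff_zeroSection ℝ (TangentSpace 𝓘(ℝ, E) : M → Type _) p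
  smul_mem' f _ hX p := .smul (f.2 p) (hX p)

/-- Every tangent vector extends to a smooth vector field. -/
theorem exists_smoothFields_apply_eq [FiniteDimensional ℝ E] [T2Space M] (p : M)
    (v : TangentSpace 𝓘(ℝ, E) p) : ∃ X : smoothFields E M, X.1 p = v := by
  obtain ⟨s, hs, hX⟩ := FiberBundle.exists_contMDiffOn_extend (k := ∞) 𝓘(ℝ, E) E v
  obtain ⟨u, hus, hu, hpu⟩ := mem_nhds_iff.mp hs
  obtain ⟨f, hf⟩ := ((SmoothBumpFunction.nhds_basis_tsupport (I := 𝓘(ℝ, E)) p).mem_iff).mp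
    (hu.mem_nhds hpu)
  refine ⟨⟨fun q ↦ f q • FiberBundle.extend E v q, fun q ↦ ?_⟩, ?_⟩
  · exact (ContMDiffOn.smul_section_of_tsupport f.contMDiff.contMDiffOn hu hf.2 (hX.mono hus)) q
  · simp

end SmoothFields

end ParaContact

/-! ### The Koszul algebra of a manifold -/

namespace ParaContact

theorem dirDeriv_const_mul {E : Type*} [NormedAddCommGroup E] [NormedSpace ℝ E]
    {M : Type*} [TopologicalSpace M] [ChartedSpace E M] (c : ℝ) {f : M → ℝ} {p : M}
    (hf : MDifferentiableAt 𝓘(ℝ, E) 𝓘(ℝ) f p)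
    (v : TangentSpace 𝓘(ℝ, E) p) : dirDeriv (fun q ↦ c * f q) p v = c * dirDeriv f p v := by
  have h := mvfderiv_mul (mdifferentiableAt_const (c := c)) hf
  have h' : (fun q ↦ c * f q) = (fun _ ↦ c) * f := rfl
  rw [dirDeriv, dirDeriv, h', h, mvfderiv_const]
  simp

section LeviCivita

variable {E : Type*} [NormedAddCommGroup E] [NormedSpace ℝ E]
  {M : Type*} [TopologicalSpace M] [ChartedSpace E M] [IsManifold 𝓘(ℝ, E) ∞ M]

theorem Connection.apply_add (D : Connection E M) {X Y : VField E M} {p : M} (hX : X.DiffAt p)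
    (hY : Y.DiffAt p) (v : TangentSpace 𝓘(ℝ, E) p) : D (X + Y) p v = D X p v + D Y p v := by
  rw [D.isCovariantDerivativeOnUniv.add hX hY]; rfl

theorem Connection.apply_smul (D : Connection E M) {f : M → ℝ} {X : VField E M} {p : M}
    (hf : MDifferentiableAt 𝓘(ℝ, E) 𝓘(ℝ) f p) (hX : X.DiffAt p) (v : TangentSpace 𝓘(ℝ, E) p) :
    D (f • X) p v = dirDeriv f p v • X p + f p • D X p v := by
  rw [D.isCovariantDerivativeOnUniv.leibniz hX hf, add_comm]; rfl

variable {ε₀ ε₁ : ℝ} {φ : EndField E M} {ξ : VField E M} {η : OneForm E M} {g : PseudoMetric E M}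
  {D : Connection E M}

/-- The Leibniz rule for `∇_X (f ξ)`, paired with `η`, recovers `X f` from quantities already known
to be smooth. -/
theorem contMDiffAt_dirDeriv (hc : IsAlmostContactMetric ε₀ ε₁ φ ξ η g) (hD : IsLeviCivita g D)
    {f : M → ℝ} (hf : ∀ p, ContMDiffAt 𝓘(ℝ, E) 𝓘(ℝ) ∞ f p) {X : VField E M}
    (hX : ∀ p, X.SmoothAt p) (p : M) :
    ContMDiffAt 𝓘(ℝ, E) 𝓘(ℝ) ∞ (fun q ↦ dirDeriv f q (X q)) p := by
  have h : (fun q ↦ dirDeriv f q (X q)) =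
      fun q ↦ η q (D (f • ξ) q (X q)) - f q * η q (D ξ q (X q)) := by
    funext q
    rw [D.apply_smul ((hf q).mdifferentiableAt (by simp)) (hc.smooth_xi q).diffAt, map_add,
      map_smul, map_smul, hc.eta_xi, smul_eq_mul, smul_eq_mul]
    ring
  rw [h]
  refine (contMDiffAt_clm_apply (hc.smooth_eta p) ?_).sub
    ((hf p).mul (contMDiffAt_clm_apply (hc.smooth_eta p) ?_))
  · exact .end_apply (hD.smooth _ p (.smul (hf p) (hc.smooth_xi p))) (hX p)
  · exact .end_apply (hD.smooth _ p (hc.smooth_xi p)) (hX p)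

theorem mlieBracket_jacobi [FiniteDimensional ℝ E] {X Y Z : VField E M} {p : M}
    (hX : X.SmoothAt p) (hY : Y.SmoothAt p) (hZ : Z.SmoothAt p)
    (hXZ : VField.DiffAt (VectorField.mlieBracket 𝓘(ℝ, E) X Z) p) :
    VectorField.mlieBracket 𝓘(ℝ, E) X (VectorField.mlieBracket 𝓘(ℝ, E) Y Z) p
      + VectorField.mlieBracket 𝓘(ℝ, E) Y (VectorField.mlieBracket 𝓘(ℝ, E) Z X) p
      + VectorField.mlieBracket 𝓘(ℝ, E) Z (VectorField.mlieBracket 𝓘(ℝ, E) X Y) p = 0 := by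
  have := FiniteDimensional.complete ℝ E
  have h₃ : IsManifold 𝓘(ℝ, E) (minSmoothness ℝ 3) M := by
    rw [minSmoothness_of_isRCLikeNormedField]; exact .of_le (n := ∞) (by norm_cast)
  have hle : minSmoothness ℝ 2 ≤ ∞ := by
    rw [minSmoothness_of_isRCLikeNormedField]; norm_cast
  have h := VectorField.leibniz_identity_mlieBracket_apply (hX.of_le hle) (hY.of_le hle)
    (hZ.of_le hle)
  have h' := VectorField.mlieBracket_const_smul_right (c := (-1 : ℝ)) (V := Y) hXZ
  have hZX : VectorField.mlieBracket 𝓘(ℝ, E) Z X =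
      (-1 : ℝ) • VectorField.mlieBracket 𝓘(ℝ, E) X Z := by
    rw [VectorField.mlieBracket_swap, neg_one_smul]
  rw [hZX, h', h, VectorField.mlieBracket_swap_apply (V := Z)]
  module

/-- The Koszul algebra of a metric `ε₀ g` and its Levi-Civita connection. -/
noncomputable def koszulAlgebra [FiniteDimensional ℝ E] [T2Space M]
    (hc : IsAlmostContactMetric ε₀ ε₁ φ ξ η g) (hD : IsLeviCivita g D) :
    KoszulAlgebra (smoothFunctions E M) (smoothFields E M) where
  nab :=
    { toFun X :=
        { toFun Y := ⟨fun p ↦ D Y.1 p (X.1 p), fun p ↦ .end_apply (hD.smooth _ p (Y.2 p)) (X.2 p)⟩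
          map_zero' := Subtype.ext <| funext fun p ↦
            congrArg (· (X.1 p)) D.isCovariantDerivativeOnUniv.zero
          map_add' Y Z := Subtype.ext <| funext fun p ↦
            D.apply_add (Y.2 p).diffAt (Z.2 p).diffAt _ }
      map_add' X Y := AddMonoidHom.ext fun Z ↦ Subtype.ext <| funext fun p ↦ map_add _ _ _
      map_smul' f X := AddMonoidHom.ext fun Z ↦ Subtype.ext <| funext fun p ↦ map_smul _ _ _ }
  der X f := ⟨fun p ↦ dirDeriv f.1 p (X.1 p), contMDiffAt_dirDeriv hc hD f.2 X.2⟩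
  g := LinearMap.mk₂ _
    (fun X Y ↦ ⟨fun p ↦ ε₀ * g.val p (X.1 p) (Y.1 p),
      fun p ↦ contMDiffAt_const.mul (g.contMDiffAt (X.2 p) (Y.2 p))⟩)
    (fun X X' Y ↦ Subtype.ext <| funext fun p ↦ by
      change ε₀ * g.val p (X.1 p + X'.1 p) _ = ε₀ * _ + ε₀ * _
      rw [map_add, add_apply, mul_add])
    (fun f X Y ↦ Subtype.ext <| funext fun p ↦ by
      change ε₀ * g.val p (f.1 p • X.1 p) _ = f.1 p * (ε₀ * _)
      rw [map_smul, smul_apply, smul_eq_mul, mul_left_comm])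
    (fun X Y Y' ↦ Subtype.ext <| funext fun p ↦ by
      change ε₀ * g.val p _ (Y.1 p + Y'.1 p) = ε₀ * _ + ε₀ * _
      rw [map_add, mul_add])
    (fun f X Y ↦ Subtype.ext <| funext fun p ↦ by
      change ε₀ * g.val p _ (f.1 p • Y.1 p) = f.1 p * (ε₀ * _)
      rw [map_smul, smul_eq_mul, mul_left_comm])
  two_cancel f hf := Subtype.ext <| funext fun p ↦ by
    have := congrFun (congrArg Subtype.val hf) p
    change 2 * f.1 p = 0 at this
    change f.1 p = 0
    linarith
  faithful f hf := Subtype.ext <| funext fun p ↦ by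
    -- The nowhere vanishing field `ξ` detects every function.
    have h : f.1 p • ξ p = 0 := congrFun (congrArg Subtype.val (hf ⟨ξ, hc.smooth_xi⟩)) p
    simpa [hc.eta_xi] using congrArg (η p) h
  nab_smul X Y f := Subtype.ext <| funext fun p ↦
    D.apply_smul ((f.2 p).mdifferentiableAt (by simp)) (Y.2 p).diffAt _
  der_g X Y Z := Subtype.ext <| funext fun p ↦ by
    change dirDeriv (fun q ↦ ε₀ * g.val q (Y.1 q) (Z.1 q)) p (X.1 p)
      = ε₀ * g.val p (D Y.1 p (X.1 p)) (Z.1 p) + ε₀ * g.val p (Y.1 p) (D Z.1 p (X.1 p))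
    rw [dirDeriv_const_mul, hD.metric _ _ _ _ (Y.2 p).diffAt (Z.2 p).diffAt, mul_add]
    exact (g.contMDiffAt (Y.2 p) (Z.2 p)).mdifferentiableAt (by simp)
  g_symm X Y := Subtype.ext <| funext fun p ↦ congrArg (ε₀ * ·) (g.symm p _ _)
  nondeg X hX := Subtype.ext <| funext fun p ↦ g.nondegenerate p _ fun w ↦ by
    obtain ⟨Y, rfl⟩ := exists_smoothFields_apply_eq p w
    have h : ε₀ * g.val p (X.1 p) (Y.1 p) = 0 := congrFun (congrArg Subtype.val (hX Y)) p
    refine (mul_eq_zero.mp h).resolve_left ?_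
    rcases hc.sign₀ with h | h <;> simp [h]
  jacobi X Y Z := by
    have tf (X Y : smoothFields E M) : (fun p ↦ D Y.1 p (X.1 p) - D X.1 p (Y.1 p)) =
        VectorField.mlieBracket 𝓘(ℝ, E) X.1 Y.1 :=
      funext fun p ↦ hD.torsion_free _ _ p (X.2 p).diffAt (Y.2 p).diffAt
    have sm (X Y : smoothFields E M) (p : M) :
        VField.SmoothAt (VectorField.mlieBracket 𝓘(ℝ, E) X.1 Y.1) p := by
      rw [← tf]
      exact ContMDiffAt.sub_section (VField.SmoothAt.end_apply (hD.smooth _ p (Y.2 p)) (X.2 p))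
        (VField.SmoothAt.end_apply (hD.smooth _ p (X.2 p)) (Y.2 p))
    refine Subtype.ext <| funext fun p ↦ ?_
    change (D (fun q ↦ D Z.1 q (Y.1 q) - D Y.1 q (Z.1 q)) p (X.1 p)
      - D X.1 p (D Z.1 p (Y.1 p) - D Y.1 p (Z.1 p)))
      + (D (fun q ↦ D X.1 q (Z.1 q) - D Z.1 q (X.1 q)) p (Y.1 p)
      - D Y.1 p (D X.1 p (Z.1 p) - D Z.1 p (X.1 p)))
      + (D (fun q ↦ D Y.1 q (X.1 q) - D X.1 q (Y.1 q)) p (Z.1 p)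
      - D Z.1 p (D Y.1 p (X.1 p) - D X.1 p (Y.1 p))) = 0
    rw [tf, tf, tf, congrFun (tf Y Z) p, congrFun (tf Z X) p, congrFun (tf X Y) p,
      hD.torsion_free _ _ p (X.2 p).diffAt (sm Y Z p).diffAt,
      hD.torsion_free _ _ p (Y.2 p).diffAt (sm Z X p).diffAt,
      hD.torsion_free _ _ p (Z.2 p).diffAt (sm X Y p).diffAt]
    exact mlieBracket_jacobi (X.2 p) (Y.2 p) (Z.2 p) (sm X Z p).diffAt

end LeviCivita

end ParaContact

namespace ParaContact

/-! ### From sectional curvature to the curvature tensor -/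

section ContactMetric

variable {E : Type*} [NormedAddCommGroup E] [NormedSpace ℝ E]
  {M : Type*} [TopologicalSpace M] [ChartedSpace E M] [IsManifold 𝓘(ℝ, E) ∞ M]
  {ε₀ ε₁ k : ℝ} {φ : EndField E M} {ξ : VField E M} {η : OneForm E M} {g : PseudoMetric E M}
  {D : Connection E M}

namespace IsAlmostContactMetric

theorem mul_self_sign₀ (hc : IsAlmostContactMetric ε₀ ε₁ φ ξ η g) : ε₀ * ε₀ = 1 := by
  rcases hc.sign₀ with h | h <;> rw [h] <;> norm_num

theorem mul_self_sign₁ (hc : IsAlmostContactMetric ε₀ ε₁ φ ξ η g) : ε₁ * ε₁ = 1 := by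
  rcases hc.sign₁ with h | h <;> rw [h] <;> norm_num

theorem phi_xi (hc : IsAlmostContactMetric ε₀ ε₁ φ ξ η g) (p : M) : φ p (ξ p) = 0 := by
  have h₁ : φ p (φ p (ξ p)) = 0 := by rw [hc.phi_sq, hc.eta_xi]; simp
  have h₂ := hc.phi_sq p (φ p (ξ p))
  rw [h₁, map_zero] at h₂
  have h₃ : φ p (ξ p) = η p (φ p (ξ p)) • ξ p := by
    have := congrArg (ε₁ • ·) h₂
    simp only [smul_smul, hc.mul_self_sign₁, one_smul, smul_zero] at this
    exact (sub_eq_zero.mp this.symm)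
  have h₄ : η p (φ p (ξ p)) * η p (φ p (ξ p)) = 0 := by
    have := congrArg (η p) (h₁.symm.trans (congrArg (φ p) h₃))
    rw [map_zero, map_smul, map_smul, smul_eq_mul] at this
    exact this.symm
  rw [h₃, mul_self_eq_zero.mp h₄, zero_smul]

theorem g_xi (hc : IsAlmostContactMetric ε₀ ε₁ φ ξ η g) (p : M) (w : TangentSpace 𝓘(ℝ, E) p) :
    g.val p (ξ p) w = ε₀ * η p w := by
  have h := hc.compat p (ξ p) w
  rw [hc.phi_xi, map_zero, zero_apply, hc.eta_xi] at h
  linear_combination ε₁ * h + (g.val p (ξ p) w - ε₀ * η p w) * -hc.mul_self_sign₁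

/-- In dimension at least `2` there is a non-isotropic horizontal vector. -/
theorem exists_horizontal (hc : IsAlmostContactMetric ε₀ ε₁ φ ξ η g)
    (hE : 1 < Module.finrank ℝ E) (p : M) :
    ∃ y : TangentSpace 𝓘(ℝ, E) p, η p y = 0 ∧ g.val p y y ≠ 0 := by
  by_contra! h
  have hg (x y : TangentSpace 𝓘(ℝ, E) p) (hx : η p x = 0) (hy : η p y = 0) :
      g.val p x y = 0 := by
    have := h (x + y) (by rw [map_add, hx, hy, add_zero])
    simp only [map_add, add_apply, h x hx, h y hy] at this
    linear_combination this / 2 - g.symm p y x / 2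
  have hx (x : TangentSpace 𝓘(ℝ, E) p) (hx : η p x = 0) : x = 0 := by
    refine g.nondegenerate p x fun w ↦ ?_
    have h₁ := hg x (w - η p w • ξ p) hx (by simp [hc.eta_xi])
    rw [map_sub, map_smul, g.symm p x (ξ p), hc.g_xi, hx] at h₁
    simpa using h₁
  refine hE.not_ge (finrank_le_one (ξ p : E) fun w : TangentSpace 𝓘(ℝ, E) p ↦ ⟨η p w, ?_⟩)
  exact (sub_eq_zero.mp (hx (w - η p w • ξ p) (by simp [hc.eta_xi]))).symm

end IsAlmostContactMetric

/-- The values of a metric at a point, as a bilinear form on smooth fields. -/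
noncomputable def KoszulAlgebra.formAt (A : KoszulAlgebra (smoothFunctions E M) (smoothFields E M))
    (p : M) : smoothFields E M →ₗ[ℝ] smoothFields E M →ₗ[ℝ] ℝ :=
  LinearMap.mk₂ ℝ (fun X Y ↦ (A.g X Y).1 p)
    (fun X X' Y ↦ by rw [map_add]; rfl)
    (fun t X Y ↦ by rw [← algebraMap_smul (smoothFunctions E M) t X, map_smul]; rfl)
    (fun X Y Y' ↦ by rw [map_add]; rfl)
    (fun t X Y ↦ by rw [← algebraMap_smul (smoothFunctions E M) t Y, map_smul]; rfl)

theorem KoszulAlgebra.excess_apply_eq_zero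
    (A : KoszulAlgebra (smoothFunctions E M) (smoothFields E M)) (p : M) (k : smoothFunctions E M)
    {X₀ Y₀ : smoothFields E M}
    (h₀ : (A.g X₀ X₀).1 p * (A.g Y₀ Y₀).1 p - (A.g X₀ Y₀).1 p ^ 2 ≠ 0)
    (h : ∀ X Y, (A.g X X).1 p * (A.g Y Y).1 p - (A.g X Y).1 p ^ 2 ≠ 0 →
      (A.excess k X Y Y X).1 p = 0) (X Y Z W : smoothFields E M) :
    (A.excess k X Y Z W).1 p = 0 := by
  refine eq_zero_of_nondegenerate_planes (fun X Y Z W ↦ (A.excess k X Y Z W).1 p) (A.formAt p)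
    (fun X X' Y Z W ↦ ?_) (fun t X Y Z W ↦ ?_) (fun X Y Z W ↦ ?_) (fun X Y Z W ↦ ?_)
    (fun X Y Z W ↦ ?_) (fun X Y ↦ ?_) h₀ h X Y Z W
  · rw [A.excess_add_left]; rfl
  · rw [← algebraMap_smul (smoothFunctions E M) t X, A.excess_smul_left]; rfl
  · rw [A.excess_swap]; rfl
  · rw [A.excess_swap']; rfl
  · exact congrFun (congrArg Subtype.val (A.excess_bianchi _ X Y Z W)) p
  · exact congrFun (congrArg Subtype.val (A.g_symm X Y)) p

variable [FiniteDimensional ℝ E] [T2Space M]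

/-- Skewness of `φ` comes from `Φ = dη`, which alternates. -/
theorem IsContactMetric.g_phi (hc : IsContactMetric ε₀ ε₁ φ ξ η g) (p : M)
    (v w : TangentSpace 𝓘(ℝ, E) p) : g.val p (φ p v) w = -g.val p v (φ p w) := by
  obtain ⟨X, rfl⟩ := exists_smoothFields_apply_eq p v
  obtain ⟨Y, rfl⟩ := exists_smoothFields_apply_eq p w
  have h₁ := hc.fundForm_eq X.1 Y.1 p (X.2 p).diffAt (Y.2 p).diffAt
  have h₂ := hc.fundForm_eq Y.1 X.1 p (Y.2 p).diffAt (X.2 p).diffAt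
  rw [extDeriv₁, fundForm] at h₁ h₂
  rw [VectorField.mlieBracket_swap_apply, map_neg] at h₂
  rw [g.symm, h₁, h₂]
  ring

theorem koszulAlgebra_g_apply (hc : IsAlmostContactMetric ε₀ ε₁ φ ξ η g) (hD : IsLeviCivita g D)
    (X Y : smoothFields E M) (p : M) :
    ((koszulAlgebra hc hD).g X Y).1 p = ε₀ * g.val p (X.1 p) (Y.1 p) := rfl

theorem koszulAlgebra_curv_apply (hc : IsAlmostContactMetric ε₀ ε₁ φ ξ η g)
    (hD : IsLeviCivita g D) (X Y Z : smoothFields E M) (p : M) :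
    ((koszulAlgebra hc hD).curv X Y Z).1 p = curvature D X.1 Y.1 Z.1 p := by
  rw [curvature, ← hD.torsion_free _ _ p (X.2 p).diffAt (Y.2 p).diffAt]
  rfl

theorem koszulAlgebra_excess_apply (hc : IsAlmostContactMetric ε₀ ε₁ φ ξ η g)
    (hD : IsLeviCivita g D) (X Y Z W : smoothFields E M) (p : M) :
    ((koszulAlgebra hc hD).excess (algebraMap ℝ _ (ε₀ * k)) X Y Z W).1 p =
      ε₀ * g.val p (curvature D X.1 Y.1 Z.1 p) (W.1 p) - ε₀ * k *
        (ε₀ * g.val p (Y.1 p) (Z.1 p) * (ε₀ * g.val p (X.1 p) (W.1 p))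
          - ε₀ * g.val p (X.1 p) (Z.1 p) * (ε₀ * g.val p (Y.1 p) (W.1 p))) := by
  rw [← koszulAlgebra_curv_apply hc hD]
  rfl

theorem excess_sectional (hc : IsAlmostContactMetric ε₀ ε₁ φ ξ η g) (hD : IsLeviCivita g D)
    (hk : HasConstantSectionalCurvature g D k) (X Y : smoothFields E M) (p : M)
    (h : gram g p (X.1 p) (Y.1 p) ≠ 0) :
    ((koszulAlgebra hc hD).excess (algebraMap ℝ _ (ε₀ * k)) X Y Y X).1 p = 0 := by
  have h₁ := hk X.1 Y.1 p (X.2 p) (Y.2 p) h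
  rw [sectionalCurvature, div_eq_iff h, gram] at h₁
  rw [koszulAlgebra_excess_apply, g.symm p (Y.1 p) (X.1 p)]
  linear_combination ε₀ * h₁ - ε₀ * k * (g.val p (X.1 p) (X.1 p) * g.val p (Y.1 p) (Y.1 p)
    - g.val p (X.1 p) (Y.1 p) ^ 2) * hc.mul_self_sign₀

/-- The difference between the curvature tensor of a metric of constant curvature and the one of
a space form vanishes. -/
theorem excess_eq_zero (hc : IsAlmostContactMetric ε₀ ε₁ φ ξ η g) (hD : IsLeviCivita g D)
    (hk : HasConstantSectionalCurvature g D k) (hE : 1 < Module.finrank ℝ E)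
    (X Y Z W : smoothFields E M) :
    (koszulAlgebra hc hD).excess (algebraMap ℝ _ (ε₀ * k)) X Y Z W = 0 := by
  refine Subtype.ext <| funext fun p ↦ ?_
  -- The plane of `ξ` and `y` is nondegenerate at `p`; it starts the polynomial argument.
  obtain ⟨y, hy, hyy⟩ := hc.exists_horizontal hE p
  obtain ⟨X₀, hX₀⟩ := exists_smoothFields_apply_eq p (ξ p)
  obtain ⟨Y₀, rfl⟩ := exists_smoothFields_apply_eq p y
  have hgram (X Y : smoothFields E M) : ((koszulAlgebra hc hD).g X X).1 p *
      ((koszulAlgebra hc hD).g Y Y).1 p - ((koszulAlgebra hc hD).g X Y).1 p ^ 2 =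
        gram g p (X.1 p) (Y.1 p) := by
    rw [koszulAlgebra_g_apply, koszulAlgebra_g_apply, koszulAlgebra_g_apply, gram]
    linear_combination (g.val p (X.1 p) (X.1 p) * g.val p (Y.1 p) (Y.1 p)
      - g.val p (X.1 p) (Y.1 p) ^ 2) * hc.mul_self_sign₀
  refine (koszulAlgebra hc hD).excess_apply_eq_zero p _ (X₀ := X₀) (Y₀ := Y₀) ?_ (fun X Y h ↦ ?_)
    X Y Z W
  · rw [hgram, gram, hX₀, hc.g_xi, hc.g_xi, hy, hc.eta_xi]
    simpa [hyy] using fun h : ε₀ = 0 ↦ by simpa [h] using hc.mul_self_sign₀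
  · rw [hgram] at h
    exact excess_sectional hc hD hk X Y p h

end ContactMetric

end ParaContact

namespace ParaContact

/-! ### The contact algebra of a manifold -/

section ContactMetric

variable {E : Type*} [NormedAddCommGroup E] [NormedSpace ℝ E]
  {M : Type*} [TopologicalSpace M] [ChartedSpace E M] [IsManifold 𝓘(ℝ, E) ∞ M]
  {ε₀ ε₁ k : ℝ} {φ : EndField E M} {ξ : VField E M} {η : OneForm E M} {g : PseudoMetric E M}
  {D : Connection E M}

theorem extDeriv₁_eq (hc : IsAlmostContactMetric ε₀ ε₁ φ ξ η g) (hD : IsLeviCivita g D)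
    {X Y : VField E M} {p : M} (hX : X.SmoothAt p) (hY : Y.SmoothAt p) :
    2 * extDeriv₁ η X Y p =
      ε₀ * g.val p (D ξ p (X p)) (Y p) - ε₀ * g.val p (D ξ p (Y p)) (X p) := by
  have h (q : M) (v : TangentSpace 𝓘(ℝ, E) q) : η q v = ε₀ * g.val q (ξ q) v := by
    rw [hc.g_xi]; linear_combination -η q v * hc.mul_self_sign₀
  have hd (X Y : VField E M) (hY : Y.SmoothAt p) : dirDeriv (fun q ↦ η q (Y q)) p (X p) =
      ε₀ * (g.val p (D ξ p (X p)) (Y p) + g.val p (ξ p) (D Y p (X p))) := by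
    simp only [h]
    rw [dirDeriv_const_mul _ ((g.contMDiffAt (hc.smooth_xi p) hY).mdifferentiableAt (by simp)),
      hD.metric _ _ _ _ (hc.smooth_xi p).diffAt hY.diffAt]
  rw [extDeriv₁, hd X Y hY, hd Y X hX, ← hD.torsion_free _ _ p hX.diffAt hY.diffAt, h, map_sub]
  ring

theorem nablaFundForm_eq (hc : IsContactMetric ε₀ ε₁ φ ξ η g) (hD : IsLeviCivita g D)
    {Y Z : VField E M} {p : M} (hY : Y.DiffAt p) (hZ : Z.DiffAt p) (v : TangentSpace 𝓘(ℝ, E) p) :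
    nablaFundForm g D φ p v Y Z =
      g.val p (Y p) (D (fun q ↦ φ q (Z q)) p v) - g.val p (Y p) (φ p (D Z p v)) := by
  have hφZ : VField.DiffAt (E := E) (M := M) (fun q ↦ φ q (Z q)) p :=
    MDifferentiableAt.clm_bundle_apply ((hc.smooth_phi p).mdifferentiableAt (by simp)) hZ
  simp only [nablaFundForm, fundForm]
  rw [hD.metric _ _ _ _ hY hφZ]
  ring

variable [FiniteDimensional ℝ E] [T2Space M]

/-- The contact algebra of a (para)contact metric manifold of constant curvature. -/
noncomputable def contactAlgebra (hc : IsContactMetric ε₀ ε₁ φ ξ η g) (hD : IsLeviCivita g D)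
    (hk : HasConstantSectionalCurvature g D k) (hE : 1 < Module.finrank ℝ E) :
    ContactAlgebra (smoothFunctions E M) (smoothFields E M) where
  toKoszulAlgebra := koszulAlgebra hc.toIsAlmostContactMetric hD
  -- Scaling both `g` and `φ` by `ε₀` preserves `Φ` and `φ²`.
  φ :=
    { toFun X := ⟨fun p ↦ ε₀ • φ p (X.1 p), fun p ↦
        .smul (f := fun _ ↦ ε₀) contMDiffAt_const (.end_apply (hc.smooth_phi p) (X.2 p))⟩
      map_add' X Y := Subtype.ext <| funext fun p ↦ by
        change ε₀ • φ p (X.1 p + Y.1 p) = ε₀ • φ p (X.1 p) + ε₀ • φ p (Y.1 p)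
        rw [map_add, smul_add]
      map_smul' f X := Subtype.ext <| funext fun p ↦ by
        change ε₀ • φ p (f.1 p • X.1 p) = f.1 p • ε₀ • φ p (X.1 p)
        rw [map_smul, smul_comm] }
  ξ := ⟨ξ, hc.smooth_xi⟩
  e := algebraMap ℝ _ ε₁
  k := algebraMap ℝ _ (ε₀ * k)
  der_e X := Subtype.ext <| funext fun p ↦
    congrArg (· (X.1 p)) (mvfderiv_const (I := 𝓘(ℝ, E)) ε₁ (x := p))
  e_mul_e := by rw [← map_mul, hc.mul_self_sign₁, map_one]
  g_ξ_ξ := Subtype.ext <| funext fun p ↦ by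
    change ε₀ * g.val p (ξ p) (ξ p) = 1
    rw [hc.g_xi, hc.eta_xi, mul_one, hc.mul_self_sign₀]
  φ_φ X := Subtype.ext <| funext fun p ↦ by
    change ε₀ • φ p (ε₀ • φ p (X.1 p)) = ε₁ • (X.1 p - (ε₀ * g.val p (ξ p) (X.1 p)) • ξ p)
    rw [hc.g_xi, ← mul_assoc, hc.mul_self_sign₀, one_mul, map_smul, smul_smul, hc.mul_self_sign₀,
      one_smul, hc.phi_sq]
  φ_ξ := Subtype.ext <| funext fun p ↦ by
    change ε₀ • φ p (ξ p) = 0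
    rw [hc.phi_xi, smul_zero]
  g_φ X Y := Subtype.ext <| funext fun p ↦ by
    change ε₀ * g.val p (ε₀ • φ p (X.1 p)) (Y.1 p) = -(ε₀ * g.val p (X.1 p) (ε₀ • φ p (Y.1 p)))
    rw [map_smul, map_smul, smul_apply, hc.g_phi, smul_neg, mul_neg]
  contact X Y := Subtype.ext <| funext fun p ↦ by
    change 2 * (ε₀ * g.val p (X.1 p) (ε₀ • φ p (Y.1 p))) =
      ε₀ * g.val p (D ξ p (X.1 p)) (Y.1 p) - ε₀ * g.val p (D ξ p (Y.1 p)) (X.1 p)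
    rw [← extDeriv₁_eq hc.toIsAlmostContactMetric hD (X.2 p) (Y.2 p),
      ← hc.fundForm_eq _ _ p (X.2 p).diffAt (Y.2 p).diffAt, fundForm, map_smul, smul_eq_mul]
    linear_combination 2 * g.val p (X.1 p) (φ p (Y.1 p)) * hc.mul_self_sign₀
  curv_eq X Y Z := by
    refine sub_eq_zero.mp ((koszulAlgebra hc.toIsAlmostContactMetric hD).nondeg _ fun W ↦ ?_)
    rw [← excess_eq_zero hc.toIsAlmostContactMetric hD hk hE X Y Z W, KoszulAlgebra.excess]
    simp only [map_sub, map_smul, LinearMap.sub_apply, LinearMap.smul_apply, smul_eq_mul]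

theorem nablaFundForm_swap (hc : IsContactMetric ε₀ ε₁ φ ξ η g) (Y Z : VField E M) (p : M)
    (v : TangentSpace 𝓘(ℝ, E) p) :
    nablaFundForm g D φ p v Y Z = -nablaFundForm g D φ p v Z Y := by
  have h (q : M) (v w : TangentSpace 𝓘(ℝ, E) q) : fundForm g φ q v w = -fundForm g φ q w v := by
    rw [fundForm, fundForm, ← hc.g_phi, g.symm]
  have h' : (fun q ↦ fundForm g φ q (Y q) (Z q)) = -fun q ↦ fundForm g φ q (Z q) (Y q) :=
    funext fun q ↦ h q _ _
  rw [nablaFundForm, nablaFundForm, h p (D Y p v), h p (Y p), dirDeriv, dirDeriv, h', mvfderiv_neg,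
    neg_apply]
  ring

/-- The values of `tensorP` depend only on the values of the fields at the point. -/
theorem tensorP_congr (hc : IsContactMetric ε₀ ε₁ φ ξ η g) (hD : IsLeviCivita g D)
    {Y Z Y' Z' : VField E M} {p : M} (hY : Y.DiffAt p) (hZ : Z.DiffAt p) (hY' : Y'.DiffAt p)
    (hZ' : Z'.DiffAt p) (hYY' : Y p = Y' p) (hZZ' : Z p = Z' p) (v : TangentSpace 𝓘(ℝ, E) p) :
    tensorP ε₀ ε₁ g D φ η p v Y Z = tensorP ε₀ ε₁ g D φ η p v Y' Z' := by
  have h {Y Z Y' : VField E M} (hY : Y.DiffAt p) (hZ : Z.DiffAt p) (hY' : Y'.DiffAt p)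
      (h : Y p = Y' p) : nablaFundForm g D φ p v Y Z = nablaFundForm g D φ p v Y' Z := by
    rw [nablaFundForm_eq hc hD hY hZ, nablaFundForm_eq hc hD hY' hZ, h]
  rw [tensorP, tensorP, h hY hZ hY' hYY', nablaFundForm_swap hc, h hZ hY' hZ' hZZ',
    ← nablaFundForm_swap hc, hYY', hZZ']

theorem tensorP_eq (hc : IsContactMetric ε₀ ε₁ φ ξ η g) (hD : IsLeviCivita g D)
    (hk : HasConstantSectionalCurvature g D k) (hE : 1 < Module.finrank ℝ E)
    (V Y Z : smoothFields E M) (p : M) :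
    tensorP ε₀ ε₁ g D φ η p (V.1 p) Y.1 Z.1 = ((contactAlgebra hc hD hk hE).p V Y Z).1 p := by
  have hφ : D (fun q ↦ ε₀ • φ q (Z.1 q)) p (V.1 p) =
      ε₀ • D (fun q ↦ φ q (Z.1 q)) p (V.1 p) := by
    have := D.isCovariantDerivativeOnUniv.smul_const ε₀ (x := p)
      (VField.SmoothAt.end_apply (hc.smooth_phi p) (Z.2 p)).diffAt
    exact congrArg (· (V.1 p)) this
  change _ = ε₀ * g.val p (Y.1 p) (D (fun q ↦ ε₀ • φ q (Z.1 q)) p (V.1 p)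
    - ε₀ • φ p (D Z.1 p (V.1 p)) + ε₁ • ((ε₀ * g.val p (V.1 p) (Z.1 p)) • ξ p
      - (ε₀ * g.val p (ξ p) (Z.1 p)) • V.1 p))
  rw [tensorP, nablaFundForm_eq hc hD (Y.2 p).diffAt (Z.2 p).diffAt, hφ]
  simp only [map_add, map_sub, map_smul, smul_eq_mul]
  rw [g.symm p (Y.1 p) (ξ p), hc.g_xi, hc.g_xi, g.symm p (Y.1 p) (V.1 p)]
  linear_combination -(g.val p (Y.1 p) (D (fun q ↦ φ q (Z.1 q)) p (V.1 p))
    - g.val p (Y.1 p) (φ p (D Z.1 p (V.1 p))) + ε₀ * ε₁ * (g.val p (V.1 p) (Z.1 p) * η p (Y.1 p)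
      - η p (Z.1 p) * g.val p (V.1 p) (Y.1 p))) * hc.mul_self_sign₀

end ContactMetric

end ParaContact

namespace ParaContact

/-! ### The role of the dimension -/

section ContactMetric

variable {E : Type*} [NormedAddCommGroup E] [NormedSpace ℝ E]
  {M : Type*} [TopologicalSpace M] [ChartedSpace E M] [IsManifold 𝓘(ℝ, E) ∞ M]
  {ε₀ ε₁ k : ℝ} {φ : EndField E M} {ξ : VField E M} {η : OneForm E M} {g : PseudoMetric E M}
  {D : Connection E M}

/-- The bilinear form `c g` on the tangent space at `p`. -/
noncomputable def PseudoMetric.form (g : PseudoMetric E M) (c : ℝ) (p : M) :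
    TangentSpace 𝓘(ℝ, E) p →ₗ[ℝ] TangentSpace 𝓘(ℝ, E) p →ₗ[ℝ] ℝ :=
  LinearMap.mk₂ ℝ (fun v w ↦ c * g.val p v w)
    (fun v v' w ↦ by rw [map_add, add_apply, mul_add])
    (fun t v w ↦ by rw [map_smul, smul_apply, smul_eq_mul, smul_eq_mul, mul_left_comm])
    (fun v w w' ↦ by rw [map_add, mul_add])
    (fun t v w ↦ by rw [map_smul, smul_eq_mul, smul_eq_mul, mul_left_comm])

theorem PseudoMetric.form_apply (g : PseudoMetric E M) (c : ℝ) (p : M)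
    (v w : TangentSpace 𝓘(ℝ, E) p) : g.form c p v w = c * g.val p v w := rfl

theorem IsOrthonormalAt.isOrthonormalBasis (hc : IsAlmostContactMetric ε₀ ε₁ φ ξ η g) {p : M}
    {ι : Type*} [Fintype ι] {e : ι → TangentSpace 𝓘(ℝ, E) p} (he : IsOrthonormalAt g p e)
    (hι : Fintype.card ι = Module.finrank ℝ E) : IsOrthonormalBasis (g.form ε₀ p) e where
  sq i := by
    rw [g.form_apply]
    rcases hc.sign₀ with h | h <;> rcases he.1 i with h' | h' <;> simp [h, h']
  orthogonal i j hij := by rw [g.form_apply, he.2 i j hij, mul_zero]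
  card := hι

/-- In dimension one the tensor `P` vanishes. -/
theorem tensorP_eq_zero (hc : IsContactMetric ε₀ ε₁ φ ξ η g) (hE : Module.finrank ℝ E = 1)
    (p : M) (v : TangentSpace 𝓘(ℝ, E) p) (Y Z : VField E M) :
    tensorP ε₀ ε₁ g D φ η p v Y Z = 0 := by
  have hξ (q : M) (x : TangentSpace 𝓘(ℝ, E) q) : x = η q x • ξ q := by
    have h0 : ξ q ≠ 0 := fun h ↦ by simpa [h] using hc.eta_xi q
    obtain ⟨c, hc'⟩ := (finrank_eq_one_iff_of_nonzero' (K := ℝ) (ξ q) h0).mp hE x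
    have hc'' : c • ξ q = x := hc'
    rw [← hc'', map_smul, hc.eta_xi, smul_eq_mul, mul_one]
  have hΦ (q : M) (x y : TangentSpace 𝓘(ℝ, E) q) : fundForm g φ q x y = 0 := by
    rw [fundForm, hξ q y, map_smul, hc.phi_xi, smul_zero, map_zero]
  have hd : dirDeriv (E := E) (fun _ : M ↦ (0 : ℝ)) p v = 0 := by
    rw [dirDeriv, mvfderiv_const, zero_apply]
  simp only [tensorP, nablaFundForm, hΦ, hd]
  rw [hξ p (Z p), hξ p (Y p)]
  simp only [map_smul, smul_eq_mul, hc.eta_xi]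
  ring

variable [FiniteDimensional ℝ E] [T2Space M]

/-- In dimension at least five the sectional curvature is `-ε₀ ε₁`. -/
theorem add_eq_zero_of_finrank (hc : IsContactMetric ε₀ ε₁ φ ξ η g) (hD : IsLeviCivita g D)
    (hk : HasConstantSectionalCurvature g D k) (hE : 3 < Module.finrank ℝ E) {p : M}
    {ι : Type*} [Fintype ι] [Nonempty ι] {e : ι → TangentSpace 𝓘(ℝ, E) p}
    (he : IsOrthonormalAt g p e) (hι : Fintype.card ι = Module.finrank ℝ E) :
    ε₁ + ε₀ * k = 0 := by
  by_contra hne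
  set A := contactAlgebra hc hD hk (by lia)
  have hu : IsUnit (A.e + A.k) := by
    have : A.e + A.k = algebraMap ℝ (smoothFunctions E M) (ε₁ + ε₀ * k) := (map_add _ _ _).symm
    rw [this]
    exact (isUnit_iff_ne_zero.mpr hne).map _
  have ev {X Y : smoothFields E M} (h : X = Y) : X.1 p = Y.1 p := by rw [h]
  have ev' {f h : smoothFunctions E M} (hf : f = h) : f.1 p = h.1 p := by rw [hf]
  refine false_of_ricci (he.isOrthonormalBasis hc.toIsAlmostContactMetric hι) (hι ▸ hE)
    (φ := ε₀ • (φ p).toLinearMap) (S := (D ξ p).toLinearMap + ε₀ • (φ p).toLinearMap)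
    (ξ := ξ p) (e := ε₁) (c := ε₁ + ε₀ * k) hne hc.mul_self_sign₁ (fun x y ↦ ?_) ?_ (fun x ↦ ?_)
    ?_ (fun x y ↦ ?_) (fun x y ↦ ?_) ?_ (fun x ↦ ?_) (fun V U Z W hZ hW ↦ ?_)
  · exact congrArg (ε₀ * ·) (g.symm p x y)
  · exact ev' A.g_ξ_ξ
  · obtain ⟨X, rfl⟩ := exists_smoothFields_apply_eq p x
    exact ev (A.φ_φ X)
  · exact ev A.φ_ξ
  · obtain ⟨X, rfl⟩ := exists_smoothFields_apply_eq p x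
    obtain ⟨Y, rfl⟩ := exists_smoothFields_apply_eq p y
    exact ev' (A.g_φ X Y)
  · obtain ⟨X, rfl⟩ := exists_smoothFields_apply_eq p x
    obtain ⟨Y, rfl⟩ := exists_smoothFields_apply_eq p y
    exact ev' (A.g_S X Y)
  · exact ev A.S_ξ
  · obtain ⟨X, rfl⟩ := exists_smoothFields_apply_eq p x
    exact ev (A.S_φ X)
  · obtain ⟨V, rfl⟩ := exists_smoothFields_apply_eq p V
    obtain ⟨U, rfl⟩ := exists_smoothFields_apply_eq p U
    obtain ⟨Z, rfl⟩ := exists_smoothFields_apply_eq p Z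
    obtain ⟨W, rfl⟩ := exists_smoothFields_apply_eq p W
    -- `Z` and `W` are horizontal only at `p`, whereas `ricci_of_isUnit` needs horizontal fields;
    -- projecting does not change the values at `p`.
    have hZ' : (Z - A.g A.ξ Z • A.ξ).1 p = Z.1 p := by
      change Z.1 p - (g.form ε₀ p (ξ p) (Z.1 p)) • ξ p = Z.1 p
      rw [hZ, zero_smul, sub_zero]
    have hW' : (W - A.g A.ξ W • A.ξ).1 p = W.1 p := by
      change W.1 p - (g.form ε₀ p (ξ p) (W.1 p)) • ξ p = W.1 p
      rw [hW, zero_smul, sub_zero]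
    have h := ev' (A.ricci_of_isUnit hu V U (A.horizontal_sub Z) (A.horizontal_sub W))
    rw [← hZ', ← hW']
    exact h

end ContactMetric

end ParaContact

/-! ### The theorem -/

theorem mainTheorem9 {E : Type*} [NormedAddCommGroup E] [NormedSpace ℝ E] [FiniteDimensional ℝ E]
    (n : ℕ) (hdim : Module.finrank ℝ E = 2 * n + 1)
    {M : Type*} [TopologicalSpace M] [T2Space M] [ChartedSpace E M] [IsManifold 𝓘(ℝ, E) ∞ M]
    (ε₀ ε₁ k : ℝ) (φ : ParaContact.EndField E M) (ξ : ParaContact.VField E M)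
    (η : ParaContact.OneForm E M) (g : ParaContact.PseudoMetric E M)
    (D : ParaContact.Connection E M)
    (hcontact : ParaContact.IsContactMetric ε₀ ε₁ φ ξ η g)
    (hD : ParaContact.IsLeviCivita g D)
    (hcurv : ParaContact.HasConstantSectionalCurvature g D k)
    (hthree : n = 1 → k = -(ε₀ * ε₁)) :
    ∀ (p : M) (e : Fin (2 * n + 1) → TangentSpace 𝓘(ℝ, E) p), ParaContact.IsOrthonormalAt g p e →
      ∀ X Y Z W : ParaContact.VField E M, X.DiffAt p → Y.DiffAt p → Z.DiffAt p → W.DiffAt p →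
        ∑ i, g.val p (e i) (e i) * ParaContact.tensorP ε₀ ε₁ g D φ η p (e i) Z X
          * ParaContact.tensorP ε₀ ε₁ g D φ η p (e i) W Y = 0 := by
  intro p e he X Y Z W hX hY hZ hW
  have h₀ := hcontact.mul_self_sign₀
  rcases Nat.eq_zero_or_pos n with rfl | hn
  · refine Finset.sum_eq_zero fun i _ ↦ ?_
    rw [ParaContact.tensorP_eq_zero hcontact (by lia), mul_zero, zero_mul]
  have hcard : Fintype.card (Fin (2 * n + 1)) = Module.finrank ℝ E := by
    rw [Fintype.card_fin, hdim]
  have hk : ε₁ + ε₀ * k = 0 := by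
    rcases Nat.eq_or_lt_of_le hn with h | h
    · rw [hthree h.symm]
      linear_combination -ε₁ * h₀
    · exact ParaContact.add_eq_zero_of_finrank hcontact hD hcurv (by lia) he hcard
  have hE : 1 < Module.finrank ℝ E := by lia
  set A := ParaContact.contactAlgebra hcontact hD hcurv hE
  have hk' : A.e + A.k = 0 := by
    have : A.e + A.k = algebraMap ℝ (ParaContact.smoothFunctions E M) (ε₁ + ε₀ * k) :=
      (map_add _ _ _).symm
    rw [this, hk, map_zero]
  obtain ⟨X', hX'⟩ := ParaContact.exists_smoothFields_apply_eq p (X p)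
  obtain ⟨Y', hY'⟩ := ParaContact.exists_smoothFields_apply_eq p (Y p)
  obtain ⟨Z', hZ'⟩ := ParaContact.exists_smoothFields_apply_eq p (Z p)
  obtain ⟨W', hW'⟩ := ParaContact.exists_smoothFields_apply_eq p (W p)
  -- The given fields are differentiable only at `p`; tensoriality replaces them by global smooth
  -- ones with the same values there.
  have hT {Y Z : ParaContact.VField E M} {Y' Z' : ParaContact.smoothFields E M} (hY : Y.DiffAt p)
      (hZ : Z.DiffAt p) (hY' : Y'.1 p = Y p) (hZ' : Z'.1 p = Z p) (i) :
      ParaContact.tensorP ε₀ ε₁ g D φ η p (e i) Y Z =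
        g.form ε₀ p (e i) ((A.T Y' Z').1 p) := by
    obtain ⟨V, hV⟩ := ParaContact.exists_smoothFields_apply_eq p (e i)
    rw [ParaContact.tensorP_congr hcontact hD hY hZ (Y'.2 p).diffAt (Z'.2 p).diffAt hY'.symm
      hZ'.symm, ← hV, ParaContact.tensorP_eq hcontact hD hcurv hE, ← A.g_T]
    rfl
  -- Parseval for `ε₀ g`: the sum over the basis is a scalar product of two values of `T`, which
  -- `g_T_T` annihilates.
  have hsum := (he.isOrthonormalBasis hcontact.toIsAlmostContactMetric hcard).sum_mul
    (fun x y ↦ congrArg (ε₀ * ·) (g.symm p x y)) ((A.T Z' X').1 p) ((A.T W' Y').1 p)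
  have h₁ : g.form ε₀ p ((A.T Z' X').1 p) ((A.T W' Y').1 p) = 0 :=
    congrFun (congrArg Subtype.val (A.g_T_T hk' Z' X' W' Y')) p
  rw [h₁] at hsum
  rw [← mul_zero ε₀, ← hsum, Finset.mul_sum]
  refine Finset.sum_congr rfl fun i _ ↦ ?_
  rw [hT hZ hX hZ' hX', hT hW hY hW' hY', g.form_apply ε₀ p (e i) (e i)]
  linear_combination -g.val p (e i) (e i) * g.form ε₀ p (e i) ((A.T Z' X').1 p) *
    g.form ε₀ p (e i) ((A.T W' Y').1 p) * h₀
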